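/- **Model.** There are $k\ge 1$ arms and $T\ge 1$ rounds. Arm $i$ has a human mean $\mu_i$, a human cost $c_i\in[0,1]$, a discount factor $\gamma_i\in[0,1]$ and a positive, (weakly) decreasing function $g_i:[0,\infty)\to\mathbb R$. All rewards lie in $[\mu_l,\mu_u]$, where $\mu_l\ge 0$: $\mu_l\le\mu_i-g_i(0)$ and $\mu_i\le\mu_u$. A link function $\sigma$ takes values in $[0,1]$ on $[\mu_l,\mu_u]^2$, is (weakly) increasing in its first and (weakly) decreasing in its second argument there, and satisfies $\sigma(x,y)+\sigma(y,x)=1$. In each round $t=1,\dots,T$ the human plays $b_t\in\{1,\dots,k\}\cup\{\emptyset\}$. Put $N_i(t)=\sum_{s\le t}\gamma_i^{\,t+1-s}\mathbf 1[b_s=i]$ and $\tilde\mu_i(t)=\mu_i-g_i(N_i(t-1))$. The GenAI plays an arm $a_t$ with $\tilde\mu_{a_t}(t)=\max_j\tilde\mu_j(t)$, and the human receives $\sigma(\mu_{b_t},\tilde\mu_{a_t}(t))-c_{b_t}$ in round $t$, or $0$ if $b_t=\emptyset$. The human's utility is the sum of these amounts over the $T$ rounds. Assume the time-insensitive setting: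 $\gamma_i=1$ for all $i$. The exit pull $n^{\rm exit}_i$ is the smallest integer $n\ge 0$ with $\sigma(\mu_i,\mu_i-g_i(n))-c_i<0$; equivalently, with $\mu_i-g_i(n)\ge\mu_i^{\rm exit}$, where $\mu_i^{\rm exit}$ is the smallest $y$ with $\sigma(\mu_i,y)-c_i<0$, whenever such a smallest value exists. Assume $n_i^{\rm exit}<\infty$ for all $i$. Let $\mathcal P(1)=\{i:\sigma(\mu_i,\max_j(\mu_j-g_j(0)))-c_i\ge 0\}$. The horizon is long if $T\ge\sum_{i\in\mathcal P(1)}n_i^{\rm exit}$. **Theorem.** There is one algorithm that, for every time-insensitive instance with finite exit pulls and a long horizon, computes in $O(Tk^3)$ steps a strategy $(b_1,\dots,b_T)$ that maximizes the human's utility; the constant is absolute. Here an algorithm is a fixed program of a unit-cost real RAM: it has arrays of natural numbers (addition, truncated subtraction, comparison) and arrays of real numbers (addition, subtraction, multiplication, comparison, conversion of naturals to reals, no rounding), knows $k$ and $T$, and may query $\mu_i$, $c_i$, $g_i(n)$ for $n\in\mathbb N$, and $\sigma(x,y)$; every operation, memory access, query and test costs one step. -/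

import Mathlib

open scoped BigOperators

noncomputable section

/-! The content-competition model between a human and a generative AI (GenAI). -/

/-- The data of a human-vs-GenAI competition with `k` arms (topics):
human means `μ`, human costs `c`, discount factors `γ`, shrinkage functions `g`,
the link function `σ` and the range `[μl, μu]` of all rewards, with the standing assumptions.
"Increasing" and "decreasing" are meant in the weak sense. -/
structure Competition (k : ℕ) where
  μ : Fin k → ℝ
  c : Fin k → ℝ
  γ : Fin k → ℝ
  g : Fin k → ℝ → ℝ
  σ : ℝ → ℝ → ℝ
  μl : ℝ
  μu : ℝ
  cost_mem : ∀ i, c i ∈ Set.Icc (0 : ℝ) 1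
  discount_mem : ∀ i, γ i ∈ Set.Icc (0 : ℝ) 1
  gap_pos : ∀ i x, 0 ≤ x → 0 < g i x
  gap_anti : ∀ i, AntitoneOn (g i) (Set.Ici 0)
  low_nonneg : 0 ≤ μl
  low_le : ∀ i, μl ≤ μ i - g i 0
  le_high : ∀ i, μ i ≤ μu
  link_mem : ∀ x ∈ Set.Icc μl μu, ∀ y ∈ Set.Icc μl μu, σ x y ∈ Set.Icc (0 : ℝ) 1
  link_compl : ∀ x ∈ Set.Icc μl μu, ∀ y ∈ Set.Icc μl μu, σ x y + σ y x = 1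
  link_mono : ∀ y ∈ Set.Icc μl μu, MonotoneOn (fun x => σ x y) (Set.Icc μl μu)
  link_anti : ∀ x ∈ Set.Icc μl μu, AntitoneOn (fun y => σ x y) (Set.Icc μl μu)

/-- A (deterministic) human strategy: the action in each of the `T` rounds, numbered from `0`;
`none` is opting out in that round. -/
abbrev Strategy (k T : ℕ) := Fin T → Option (Fin k)

namespace Competition

variable {k T : ℕ}

/-- Generative mean of arm `i` when it has (discounted) number of human pulls `x`. -/
def genMean (M : Competition k) (i : Fin k) (x : ℝ) : ℝ := M.μ i - M.g i x

/-- Discounted number of human pulls of arm `i` after the first `n` rounds.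
The pull in the round of index `s` (the `(s+1)`-st round) has weight `γ ^ (n + 1 - (s + 1))`. -/
def pulls (M : Competition k) (b : Strategy k T) (i : Fin k) (n : ℕ) : ℝ :=
  ∑ s : Fin T, if (s : ℕ) < n ∧ b s = some i then M.γ i ^ (n - (s : ℕ)) else 0

/-- `a` is a myopic GenAI response to `b`: in each round the GenAI selects an arm whose
current generative mean is highest (ties broken in any way). -/
def IsMyopicResponse (M : Competition k) (b : Strategy k T) (a : Fin T → Fin k) : Prop :=
  ∀ (t : Fin T) (j : Fin k),
    M.genMean j (M.pulls b j t) ≤ M.genMean (a t) (M.pulls b (a t) t)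

/-- The human's accumulated utility when the human plays `b` and the GenAI plays `a`. -/
def humanUtility (M : Competition k) (b : Strategy k T) (a : Fin T → Fin k) : ℝ :=
  ∑ t : Fin T,
    match b t with
    | none => 0
    | some i => M.σ (M.μ i) (M.genMean (a t) (M.pulls b (a t) t)) - M.c i

/-- `b` maximizes the human's utility against the myopic GenAI. -/
def IsOptimal (M : Competition k) (b : Strategy k T) : Prop :=
  ∀ a : Fin T → Fin k, M.IsMyopicResponse b a →
    ∀ (b' : Strategy k T) (a' : Fin T → Fin k), M.IsMyopicResponse b' a' →
      M.humanUtility b' a' ≤ M.humanUtility b a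

/-- All arms are time-insensitive. -/
def IsTimeInsensitive (M : Competition k) : Prop := ∀ i, M.γ i = 1

/-- The rewards against which the human's utility from pulling arm `i` is negative.
It is an upper set in `[μl, μu]`; its least element, if there is one, is the exit mean of `i`. -/
def negativeRange (M : Competition k) (i : Fin k) : Set ℝ :=
  {y | y ∈ Set.Icc M.μl M.μu ∧ M.σ (M.μ i) y - M.c i < 0}

/-- `m` is the exit mean of arm `i`. -/
def IsExitMean (M : Competition k) (i : Fin k) (m : ℝ) : Prop := IsLeast (M.negativeRange i) m

/-- The number `n` of pulls brings arm `i` to (or beyond) its exit: its generative mean has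
entered the range of negative utility. If `i` has an exit mean `m`, this says
`m ≤ μ i - g i n`, see `reachesExit_iff`; the present form also makes sense for, say,
continuous `σ`, where a least value of negative utility does not exist. -/
def ReachesExit (M : Competition k) (i : Fin k) (n : ℕ) : Prop :=
  M.genMean i n ∈ M.negativeRange i

/-- The exit pull of arm `i`: the smallest `n` that reaches the exit
(used only under `HasExitPulls`). -/
def exitPull (M : Competition k) (i : Fin k) : ℕ := sInf {n : ℕ | M.ReachesExit i n}

/-- The exit pull of each arm is finite. -/
def HasExitPulls (M : Competition k) : Prop := ∀ i, ∃ n : ℕ, M.ReachesExit i n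

/-- The highest generative mean when the numbers of pulls are `x`. -/
def topMean [NeZero k] (M : Competition k) (x : Fin k → ℝ) : ℝ :=
  Finset.univ.sup' Finset.univ_nonempty fun i => M.genMean i (x i)

open Classical in
/-- The plausible arms when the numbers of pulls are `x`: those that give the human
non-negative utility in the next round. -/
def plausible [NeZero k] (M : Competition k) (x : Fin k → ℝ) : Finset (Fin k) :=
  {i | 0 ≤ M.σ (M.μ i) (M.topMean x) - M.c i}

/-- The horizon `T` is long: it is at least the sum of the exit pulls of the arms that are
plausible in the first round. -/
def IsLongHorizon [NeZero k] (M : Competition k) (T : ℕ) : Prop :=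
  ∑ i ∈ M.plausible 0, M.exitPull i ≤ T

theorem genMean_mem (M : Competition k) (i : Fin k) {x : ℝ} (hx : 0 ≤ x) :
    M.genMean i x ∈ Set.Icc M.μl M.μu := by
  have h1 := M.gap_anti i (Set.mem_Ici.2 le_rfl) (Set.mem_Ici.2 hx) hx
  have h2 := M.gap_pos i x hx
  have h3 := M.low_le i
  have h4 := M.le_high i
  constructor <;> unfold genMean <;> linarith

theorem mean_mem (M : Competition k) (i : Fin k) : M.μ i ∈ Set.Icc M.μl M.μu := by
  have h1 := M.gap_pos i 0 le_rfl
  have h2 := M.low_le i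
  exact ⟨by linarith, M.le_high i⟩

theorem mem_negativeRange_iff (M : Competition k) {i : Fin k} {m y : ℝ} (hm : M.IsExitMean i m)
    (hy : y ∈ Set.Icc M.μl M.μu) : y ∈ M.negativeRange i ↔ m ≤ y := by
  refine ⟨fun h => hm.2 h, fun h => ⟨hy, ?_⟩⟩
  have h1 := M.link_anti (M.μ i) (M.mean_mem i) hm.1.1 hy h
  have h2 := hm.1.2
  simp only at h1
  linarith

/-- Agreement with the definition through the exit mean, when that exists. -/
theorem reachesExit_iff (M : Competition k) {i : Fin k} {m : ℝ} (hm : M.IsExitMean i m) (n : ℕ) :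
    M.ReachesExit i n ↔ m ≤ M.μ i - M.g i n :=
  M.mem_negativeRange_iff hm (M.genMean_mem i n.cast_nonneg)

/-- Agreement with the description of plausible arms through the exit mean, when that exists. -/
theorem mem_plausible_iff [NeZero k] (M : Competition k) {i : Fin k} {m : ℝ}
    (hm : M.IsExitMean i m) {x : Fin k → ℝ} (hx : ∀ j, 0 ≤ x j) :
    i ∈ M.plausible x ↔ M.topMean x < m := by
  obtain ⟨j, -, hj⟩ := Finset.exists_mem_eq_sup' (Finset.univ_nonempty (α := Fin k))
    fun i => M.genMean i (x i)
  have ht : M.topMean x ∈ Set.Icc M.μl M.μu := by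
    have h := M.genMean_mem j (hx j)
    rw [← hj] at h
    exact h
  rw [← not_le, ← M.mem_negativeRange_iff hm ht]
  simp [plausible, negativeRange, ht.1, ht.2]

end Competition

/-! A unit-cost real RAM. Programs work on arrays of natural numbers and arrays of real numbers
(both named by natural numbers), and have access to `k`, `T` and to the data `μ`, `c`, `g`, `σ` of
the instance through queries. Naturals can be added, subtracted (truncated at `0`) and compared;
reals can be added, subtracted, multiplied and compared, but not rounded. Every operation, memory
access, query and test costs one step. -/

namespace RealRAM

/-- The memory: `nat a i` and `real a i` are the entries of index `i` of the arrays named `a`. -/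
structure Store where
  nat : ℕ → ℕ → ℕ
  real : ℕ → ℕ → ℝ

/-- The initial memory. -/
def Store.zero : Store := ⟨fun _ _ => 0, fun _ _ => 0⟩

/-- Overwrite one natural-number entry. -/
def Store.setNat (s : Store) (a i v : ℕ) : Store :=
  { s with nat := Function.update s.nat a (Function.update (s.nat a) i v) }

/-- Overwrite one real entry. -/
def Store.setReal (s : Store) (a i : ℕ) (v : ℝ) : Store :=
  { s with real := Function.update s.real a (Function.update (s.real a) i v) }

/-- Natural-number expressions. -/
inductive NExp where
  | lit (n : ℕ)
  | arms
  | horizon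
  | get (a : ℕ) (i : NExp)
  | add (e f : NExp)
  | sub (e f : NExp)

/-- Real expressions. -/
inductive RExp where
  | cast (e : NExp)
  | get (a : ℕ) (i : NExp)
  | add (e f : RExp)
  | sub (e f : RExp)
  | mul (e f : RExp)
  | askMean (i : NExp)
  | askCost (i : NExp)
  | askGap (i n : NExp)
  | askLink (x y : RExp)

/-- Tests. -/
inductive BExp where
  | natLe (e f : NExp)
  | realLe (e f : RExp)
  | neg (b : BExp)
  | conj (b d : BExp)

/-- Programs. -/
inductive Prog where
  | skip
  | setNat (a : ℕ) (i e : NExp)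
  | setReal (a : ℕ) (i : NExp) (e : RExp)
  | seq (p q : Prog)
  | cond (b : BExp) (p q : Prog)
  | loop (b : BExp) (p : Prog)

/-- Number of steps to evaluate an expression. -/
def NExp.steps : NExp → ℕ
  | lit _ => 1
  | arms => 1
  | horizon => 1
  | get _ i => i.steps + 1
  | add e f => e.steps + f.steps + 1
  | sub e f => e.steps + f.steps + 1

/-- Number of steps to evaluate an expression. -/
def RExp.steps : RExp → ℕ
  | cast e => e.steps + 1
  | get _ i => i.steps + 1
  | add e f => e.steps + f.steps + 1
  | sub e f => e.steps + f.steps + 1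
  | mul e f => e.steps + f.steps + 1
  | askMean i => i.steps + 1
  | askCost i => i.steps + 1
  | askGap i n => i.steps + n.steps + 1
  | askLink x y => x.steps + y.steps + 1

/-- Number of steps to evaluate a test. -/
def BExp.steps : BExp → ℕ
  | natLe e f => e.steps + f.steps + 1
  | realLe e f => e.steps + f.steps + 1
  | neg b => b.steps + 1
  | conj b d => b.steps + d.steps + 1

/-- Value of a natural-number expression. -/
def NExp.eval (k T : ℕ) (s : Store) : NExp → ℕ
  | lit n => n
  | arms => k
  | horizon => T
  | get a i => s.nat a (i.eval k T s)
  | add e f => e.eval k T s + f.eval k T s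
  | sub e f => e.eval k T s - f.eval k T s

/-- Value of a real expression; queries about arms that do not exist are answered by `0`. -/
def RExp.eval {k : ℕ} (M : Competition k) (T : ℕ) (s : Store) : RExp → ℝ
  | cast e => (e.eval k T s : ℝ)
  | get a i => s.real a (i.eval k T s)
  | add e f => e.eval M T s + f.eval M T s
  | sub e f => e.eval M T s - f.eval M T s
  | mul e f => e.eval M T s * f.eval M T s
  | askMean i => if h : i.eval k T s < k then M.μ ⟨i.eval k T s, h⟩ else 0
  | askCost i => if h : i.eval k T s < k then M.c ⟨i.eval k T s, h⟩ else 0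
  | askGap i n =>
      if h : i.eval k T s < k then M.g ⟨i.eval k T s, h⟩ (n.eval k T s : ℝ) else 0
  | askLink x y => M.σ (x.eval M T s) (y.eval M T s)

/-- Truth of a test. -/
def BExp.Holds {k : ℕ} (M : Competition k) (T : ℕ) (s : Store) : BExp → Prop
  | natLe e f => e.eval k T s ≤ f.eval k T s
  | realLe e f => e.eval M T s ≤ f.eval M T s
  | neg b => ¬ b.Holds M T s
  | conj b d => b.Holds M T s ∧ d.Holds M T s

/-- `Exec M T p s n s'`: on the instance `(M, T)`, program `p`, started in memory `s`, halts after
exactly `n` steps in memory `s'`. -/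
inductive Exec {k : ℕ} (M : Competition k) (T : ℕ) : Prog → Store → ℕ → Store → Prop
  | skip (s : Store) : Exec M T .skip s 1 s
  | setNat (a : ℕ) (i e : NExp) (s : Store) :
      Exec M T (.setNat a i e) s (i.steps + e.steps + 1)
        (s.setNat a (i.eval k T s) (e.eval k T s))
  | setReal (a : ℕ) (i : NExp) (e : RExp) (s : Store) :
      Exec M T (.setReal a i e) s (i.steps + e.steps + 1)
        (s.setReal a (i.eval k T s) (e.eval M T s))
  | seq {p q : Prog} {s s' s'' : Store} {m n : ℕ} :
      Exec M T p s m s' → Exec M T q s' n s'' → Exec M T (.seq p q) s (m + n) s''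
  | cond_true {b : BExp} {p q : Prog} {s s' : Store} {n : ℕ} :
      b.Holds M T s → Exec M T p s n s' → Exec M T (.cond b p q) s (b.steps + n + 1) s'
  | cond_false {b : BExp} {p q : Prog} {s s' : Store} {n : ℕ} :
      ¬ b.Holds M T s → Exec M T q s n s' → Exec M T (.cond b p q) s (b.steps + n + 1) s'
  | loop_done {b : BExp} {p : Prog} {s : Store} :
      ¬ b.Holds M T s → Exec M T (.loop b p) s (b.steps + 1) s
  | loop_step {b : BExp} {p : Prog} {s s' s'' : Store} {m n : ℕ} :
      b.Holds M T s → Exec M T p s m s' → Exec M T (.loop b p) s' n s'' →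
      Exec M T (.loop b p) s (b.steps + m + n + 1) s''

/-- The strategy written in the natural-number array `0`: entry `t` is the arm pulled in the round
of index `t`; an entry that is not an arm means opting out. -/
def Store.output (s : Store) (k T : ℕ) : Strategy k T := fun t =>
  if h : s.nat 0 t < k then some ⟨s.nat 0 t, h⟩ else none

end RealRAM

end

noncomputable section

namespace Competition

variable {k : ℕ} (M : Competition k)

theorem genMean_mono (i : Fin k) {m n : ℕ} (h : m ≤ n) : M.genMean i m ≤ M.genMean i n := by
  have := M.gap_anti i (Set.mem_Ici.2 (Nat.cast_nonneg m)) (Set.mem_Ici.2 (Nat.cast_nonneg n))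
    (Nat.cast_le.2 h)
  unfold genMean
  linarith

variable [NeZero k]

/-- The highest generative mean when the arms have been pulled `x` times. -/
def top (x : Fin k → ℕ) : ℝ := M.topMean fun i => (x i : ℝ)

/-- The human's reward from pulling `i` when the arms have been pulled `x` times. -/
def gain (i : Fin k) (x : Fin k → ℕ) : ℝ := M.σ (M.μ i) (M.top x) - M.c i

/-- The positive part of the gain. -/
def posGain (i : Fin k) (x : Fin k → ℕ) : ℝ := max (M.gain i x) 0

theorem genMean_le_top (i : Fin k) (x : Fin k → ℕ) : M.genMean i (x i) ≤ M.top x :=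
  Finset.le_sup' (fun i => M.genMean i (x i : ℝ)) (Finset.mem_univ i)

theorem top_le_iff {x : Fin k → ℕ} {y : ℝ} : M.top x ≤ y ↔ ∀ i, M.genMean i (x i) ≤ y := by
  simp [top, topMean]

theorem exists_top_eq (x : Fin k → ℕ) : ∃ i, M.top x = M.genMean i (x i) := by
  obtain ⟨j, -, hj⟩ := Finset.exists_mem_eq_sup' (Finset.univ_nonempty (α := Fin k))
    fun i => M.genMean i (x i)
  exact ⟨j, hj⟩

theorem top_mem (x : Fin k → ℕ) : M.top x ∈ Set.Icc M.μl M.μu := by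
  obtain ⟨j, hj⟩ := M.exists_top_eq x
  rw [hj]
  exact M.genMean_mem j (Nat.cast_nonneg _)

theorem top_mono {x x' : Fin k → ℕ} (h : x ≤ x') : M.top x ≤ M.top x' :=
  M.top_le_iff.2 fun i => (M.genMean_mono i (h i)).trans (M.genMean_le_top i x')

theorem gain_le_gain (i : Fin k) {x x' : Fin k → ℕ} (h : M.top x ≤ M.top x') :
    M.gain i x' ≤ M.gain i x :=
  sub_le_sub_right (M.link_anti _ (M.mean_mem i) (M.top_mem x) (M.top_mem x') h) _

theorem gain_congr (i : Fin k) {x x' : Fin k → ℕ} (h : M.top x = M.top x') :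
    M.gain i x = M.gain i x' := by
  simp only [gain, h]

theorem posGain_nonneg (i : Fin k) (x : Fin k → ℕ) : 0 ≤ M.posGain i x := le_max_right _ _

theorem gain_le_posGain (i : Fin k) (x : Fin k → ℕ) : M.gain i x ≤ M.posGain i x :=
  le_max_left _ _

theorem posGain_le_posGain (i : Fin k) {x x' : Fin k → ℕ} (h : M.top x ≤ M.top x') :
    M.posGain i x' ≤ M.posGain i x :=
  max_le_max (M.gain_le_gain i h) le_rfl

theorem top_add_single (x : Fin k → ℕ) (i : Fin k) :
    M.top (x + Pi.single i 1) = max (M.top x) (M.genMean i ((x i + 1 : ℕ) : ℝ)) := by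
  apply le_antisymm
  · rw [top_le_iff]
    intro j
    by_cases h : j = i
    · subst h
      simp
    · simpa [h] using Or.inl (M.genMean_le_top j x)
  · refine max_le (M.top_mono (by simp)) ?_
    have h := M.genMean_le_top i (x + Pi.single i 1)
    rwa [Pi.add_apply, Pi.single_eq_same] at h

/-- The highest utility that the human can collect in `n` rounds, starting from pulls `x`. -/
def opt : ℕ → (Fin k → ℕ) → ℝ
  | 0, _ => 0
  | n + 1, x => max (opt n x)
      (Finset.univ.sup' Finset.univ_nonempty fun i => M.gain i x + opt n (x + Pi.single i 1))

theorem opt_le_succ (n : ℕ) (x : Fin k → ℕ) : M.opt n x ≤ M.opt (n + 1) x := le_max_left _ _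

theorem gain_add_opt_le (n : ℕ) (x : Fin k → ℕ) (i : Fin k) :
    M.gain i x + M.opt n (x + Pi.single i 1) ≤ M.opt (n + 1) x :=
  (Finset.le_sup' (fun i => M.gain i x + M.opt n (x + Pi.single i 1))
    (Finset.mem_univ i)).trans (le_max_right _ _)

theorem opt_succ_le {n : ℕ} {x : Fin k → ℕ} {v : ℝ} (h : M.opt n x ≤ v)
    (h' : ∀ i, M.gain i x + M.opt n (x + Pi.single i 1) ≤ v) : M.opt (n + 1) x ≤ v :=
  max_le h (Finset.sup'_le _ _ fun i _ => h' i)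

theorem opt_anti (n : ℕ) {x x' : Fin k → ℕ} (h : x ≤ x') : M.opt n x' ≤ M.opt n x := by
  induction n generalizing x x' with
  | zero => exact le_rfl
  | succ n ih =>
    refine M.opt_succ_le ((ih h).trans (M.opt_le_succ n x)) fun i => ?_
    refine le_trans (add_le_add (M.gain_le_gain i (M.top_mono h)) (ih ?_))
      (M.gain_add_opt_le n x i)
    exact add_le_add_left h _

/-- A pull that does not raise the top mean may be made at once. -/
theorem opt_le_of_free (n : ℕ) {x : Fin k → ℕ} {i : Fin k}
    (h : M.genMean i ((x i + 1 : ℕ) : ℝ) ≤ M.top x) :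
    M.opt n x ≤ M.posGain i x + M.opt n (x + Pi.single i 1) := by
  induction n generalizing x with
  | zero => simpa [opt] using M.posGain_nonneg i x
  | succ n ih =>
    have htop : M.top (x + Pi.single i 1) = M.top x := by
      rw [top_add_single, max_eq_left h]
    refine M.opt_succ_le ((ih h).trans (by gcongr; exact M.opt_le_succ _ _)) fun j => ?_
    by_cases hj : j = i
    · subst hj
      exact add_le_add (M.gain_le_posGain _ _) (M.opt_le_succ _ _)
    · have hle : M.top x ≤ M.top (x + Pi.single j 1) := M.top_mono (by simp)
      have h1 := ih (x := x + Pi.single j 1) (by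
        simpa [Ne.symm hj] using h.trans hle)
      have h2 := M.posGain_le_posGain i hle
      have h3 := M.gain_add_opt_le n (x + Pi.single i 1) j
      rw [M.gain_congr j htop, add_right_comm] at h3
      linarith

theorem opt_le_of_top_eq (n : ℕ) {x x' : Fin k → ℕ} (hx : x ≤ x') (h : M.top x = M.top x') :
    M.opt n x ≤ (∑ j, ((x' j : ℝ) - x j) * M.posGain j x') + M.opt n x' := by
  obtain ⟨d, hd⟩ : ∃ d, ∑ j, (x' j - x j) = d := ⟨_, rfl⟩
  induction d generalizing x with
  | zero =>
    have : x = x' := by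
      funext j
      have := (Finset.sum_eq_zero_iff.1 hd) j (Finset.mem_univ j)
      have : x j ≤ x' j := hx j
      omega
    subst this
    simp
  | succ d ih =>
    obtain ⟨i, hi⟩ : ∃ i, x i < x' i := by
      by_contra! hc
      have : ∑ j, (x' j - x j) = 0 := Finset.sum_eq_zero fun j _ => by
        have := hc j
        omega
      omega
    have hle : x + Pi.single i 1 ≤ x' := by
      intro j
      by_cases hj : j = i
      · subst hj
        simpa using hi
      · simpa [hj] using hx j
    have hfree : M.genMean i ((x i + 1 : ℕ) : ℝ) ≤ M.top x := by
      rw [h]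
      exact (M.genMean_mono i hi).trans (M.genMean_le_top i x')
    have htop : M.top (x + Pi.single i 1) = M.top x := by
      rw [top_add_single, max_eq_left hfree]
    have hsum : ∑ j, (x' j - (x + Pi.single i 1 : Fin k → ℕ) j) = d := by
      have h1 : ∑ j, (x' j - x j) = ∑ j, ((x' j - (x + Pi.single i 1 : Fin k → ℕ) j) +
          (Pi.single i 1 : Fin k → ℕ) j) := by
        refine Finset.sum_congr rfl fun j _ => ?_
        have := hle j
        simp only [Pi.add_apply] at this ⊢
        omega
      rw [Finset.sum_add_distrib, Finset.sum_pi_single'] at h1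
      simp only [Finset.mem_univ, if_true] at h1
      omega
    have h1 := ih hle (htop.trans h) hsum
    have h2 := M.opt_le_of_free n hfree
    have h3 : M.posGain i x = M.posGain i x' := by simp only [posGain, M.gain_congr i h]
    have h4 : ∑ j, ((x' j : ℝ) - ((x + Pi.single i 1 : Fin k → ℕ) j : ℕ)) * M.posGain j x' =
        (∑ j, ((x' j : ℝ) - x j) * M.posGain j x') - M.posGain i x' := by
      have : ∀ j, ((x' j : ℝ) - ((x + Pi.single i 1 : Fin k → ℕ) j : ℕ)) * M.posGain j x' =
          ((x' j : ℝ) - x j) * M.posGain j x' - if i = j then M.posGain j x' else 0 := by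
        intro j
        by_cases hj : i = j
        · subst hj
          simp
          ring
        · simp [hj, Ne.symm hj]
      rw [Finset.sum_congr rfl fun j _ => this j, Finset.sum_sub_distrib]
      simp
    linarith

end Competition

/-- How often the sequence `w` takes the value `i` before index `t`. -/
def occ (w : ℕ → ℕ) (t i : ℕ) : ℕ := ((Finset.range t).filter fun s => w s = i).card

theorem occ_zero (w : ℕ → ℕ) (i : ℕ) : occ w 0 i = 0 := by simp [occ]

theorem occ_succ (w : ℕ → ℕ) (t i : ℕ) : occ w (t + 1) i = occ w t i + if w t = i then 1 else 0 := by
  by_cases h : w t = i <;> simp [occ, Finset.range_add_one, Finset.filter_insert, h]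

theorem occ_congr {w w' : ℕ → ℕ} {t : ℕ} (h : ∀ s < t, w s = w' s) : occ w t = occ w' t := by
  funext i
  unfold occ
  congr 1
  exact Finset.filter_congr fun s hs => by rw [h s (Finset.mem_range.1 hs)]

theorem occ_mono (w : ℕ → ℕ) (i : ℕ) {s t : ℕ} (h : s ≤ t) : occ w s i ≤ occ w t i :=
  Finset.card_le_card (Finset.filter_subset_filter _ (Finset.range_mono h))

theorem occ_eq_of_forall_ne {w : ℕ → ℕ} {i s t : ℕ} (hst : s ≤ t)
    (h : ∀ r, s ≤ r → r < t → w r ≠ i) : occ w t i = occ w s i := by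
  induction t, hst using Nat.le_induction with
  | base => rfl
  | succ t ht ih =>
    rw [occ_succ, ih fun r hr hr' => h r hr (by omega), if_neg (h t ht (by omega)), add_zero]

/-- The first index after `t` whose preceding entry of `w` is `j` is `t'`. -/
structure IsNext (w : ℕ → ℕ) (t j t' : ℕ) : Prop where
  lt : t < t'
  eq : w (t' - 1) = j
  ne : ∀ s, t ≤ s → s + 1 < t' → w s ≠ j

namespace Competition

variable {k T : ℕ}

/-- The pulls of the arms in the first `t` entries of `w`. -/
def count (w : ℕ → ℕ) (t : ℕ) : Fin k → ℕ := fun i => occ w t i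

theorem count_succ (w : ℕ → ℕ) (t : ℕ) (i : Fin k) :
    count w (t + 1) i = count w t i + if w t = i then 1 else 0 := occ_succ w t i

theorem count_succ_arm {w : ℕ → ℕ} {t : ℕ} {i : Fin k} (h : w t = i) :
    count w (t + 1) = count w t + Pi.single i 1 := by
  funext j
  rw [count_succ, h, Pi.add_apply, Pi.single_apply]
  congr 1
  simp only [Fin.ext_iff, eq_comm]

theorem count_succ_none {w : ℕ → ℕ} {t : ℕ} (h : ¬ w t < k) :
    (count w (t + 1) : Fin k → ℕ) = count w t := by
  funext j
  rw [count_succ, if_neg, add_zero]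
  have := j.2
  omega

theorem count_mono (w : ℕ → ℕ) {s t : ℕ} (h : s ≤ t) : (count w s : Fin k → ℕ) ≤ count w t :=
  fun i => occ_mono w i h

theorem count_congr {w w' : ℕ → ℕ} {t : ℕ} (h : ∀ s < t, w s = w' s) :
    (count w t : Fin k → ℕ) = count w' t := by
  funext i
  exact congrFun (occ_congr h) i

theorem _root_.IsNext.count_eq {w : ℕ → ℕ} {t t' : ℕ} {j : Fin k} (h : IsNext w t j t') {s : ℕ} (hs : t ≤ s)
    (hs' : s < t') : count w s j = count w t j :=
  occ_eq_of_forall_ne hs fun r hr hr' => h.ne r hr (by omega)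

theorem count_add_single_le {w : ℕ → ℕ} {t t' : ℕ} {j : Fin k} (h : w (t' - 1) = j)
    (ht : t < t') : count w t + Pi.single j 1 ≤ count w t' := by
  have h1 : count w t' = count w (t' - 1) + Pi.single j 1 := by
    rw [← count_succ_arm h]
    congr 1
    omega
  rw [h1]
  exact add_le_add_left (count_mono w (by omega)) _

theorem pulls_eq_count (M : Competition k) (hM : M.IsTimeInsensitive) (b : Strategy k T) {w : ℕ → ℕ}
    (hw : ∀ (t : Fin T) (i : Fin k), b t = some i ↔ w t = i) (i : Fin k) {n : ℕ} (hn : n ≤ T) :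
    M.pulls b i n = (count w n i : ℕ) := by
  have h1 : M.pulls b i n = ∑ s ∈ Finset.range T, if s < n ∧ w s = i then (1 : ℝ) else 0 := by
    rw [pulls, Finset.sum_range]
    refine Finset.sum_congr rfl fun s _ => ?_
    simp only [hM i, one_pow, hw]
  rw [h1, ← Finset.sum_filter, Finset.sum_const, nsmul_eq_mul, mul_one]
  rw [count, occ]
  congr 2
  ext s
  simp only [Finset.mem_filter, Finset.mem_range]
  constructor
  · rintro ⟨-, h⟩
    exact h
  · rintro ⟨h, h'⟩
    exact ⟨by omega, h, h'⟩

variable [NeZero k] (M : Competition k)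

/-- The utility collected in the first `n` rounds when `w` is played; entries that are not arms
mean opting out. -/
def util (w : ℕ → ℕ) (n : ℕ) : ℝ :=
  ∑ t ∈ Finset.range n, if h : w t < k then M.gain ⟨w t, h⟩ (count w t) else 0

theorem util_succ_arm {w : ℕ → ℕ} {t : ℕ} {i : Fin k} (h : w t = i) :
    M.util w (t + 1) = M.util w t + M.gain i (count w t) := by
  simp [util, Finset.sum_range_succ, h]

theorem util_succ_none {w : ℕ → ℕ} {t : ℕ} (h : ¬ w t < k) :
    M.util w (t + 1) = M.util w t := by
  simp [util, Finset.sum_range_succ, h]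

theorem util_congr {w w' : ℕ → ℕ} {n : ℕ} (h : ∀ s < n, w s = w' s) :
    M.util w n = M.util w' n := by
  refine Finset.sum_congr rfl fun t ht => ?_
  have ht := Finset.mem_range.1 ht
  have h1 : (count w t : Fin k → ℕ) = count w' t := count_congr fun s hs => h s (by omega)
  simp only [h t ht, h1]

theorem util_add_opt_le (w : ℕ → ℕ) (n m : ℕ) :
    M.util w n + M.opt m (count w n) ≤ M.opt (n + m) 0 := by
  induction n generalizing m with
  | zero =>
    have : (count w 0 : Fin k → ℕ) = 0 := funext fun i => occ_zero w i
    simp [util, this]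
  | succ n ih =>
    have h1 := ih (m + 1)
    rw [show n + 1 + m = n + (m + 1) by ring]
    by_cases h : w n < k
    · have h2 : w n = (⟨w n, h⟩ : Fin k) := rfl
      rw [M.util_succ_arm h2, count_succ_arm h2]
      have := M.gain_add_opt_le m (count w n) ⟨w n, h⟩
      linarith
    · rw [M.util_succ_none h, count_succ_none h]
      have := M.opt_le_succ m (count w n)
      linarith

theorem util_le_opt (w : ℕ → ℕ) (n : ℕ) : M.util w n ≤ M.opt n 0 :=
  M.util_add_opt_le w n 0 |>.trans' (by simp [opt])

theorem humanUtility_eq_util (hM : M.IsTimeInsensitive) (b : Strategy k T) {w : ℕ → ℕ}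
    (hw : ∀ (t : Fin T) (i : Fin k), b t = some i ↔ w t = i) {a : Fin T → Fin k}
    (ha : M.IsMyopicResponse b a) : M.humanUtility b a = M.util w T := by
  rw [util, Finset.sum_range]
  refine Finset.sum_congr rfl fun t _ => ?_
  have hp := fun i => M.pulls_eq_count hM b hw i t.2.le
  have htop : M.genMean (a t) (M.pulls b (a t) t) = M.top (count w t) := by
    apply le_antisymm
    · rw [hp]
      exact M.genMean_le_top (a t) (count w t)
    · rw [top_le_iff]
      intro i
      rw [← hp]
      exact ha t i
  cases hb : b t with
  | none =>
    rw [dif_neg]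
    intro h
    have := (hw t ⟨w t, h⟩).2 rfl
    rw [hb] at this
    cases this
  | some i =>
    have := (hw t i).1 hb
    simp only [this, Fin.is_lt, dite_true, htop]
    rfl

theorem isOptimal_of_opt_le_util (hM : M.IsTimeInsensitive) (b : Strategy k T) {w : ℕ → ℕ}
    (hw : ∀ (t : Fin T) (i : Fin k), b t = some i ↔ w t = i) (h : M.opt T 0 ≤ M.util w T) :
    M.IsOptimal b := by
  intro a ha b' a' ha'
  rw [M.humanUtility_eq_util hM b hw ha]
  refine le_trans ?_ h
  rw [M.humanUtility_eq_util hM b' (w := fun t => if h : t < T then (b' ⟨t, h⟩).elim k Fin.val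
    else k) ?_ ha']
  · exact M.util_le_opt _ _
  · intro t i
    cases hb : b' t with
    | none => simpa [hb] using i.2.ne'
    | some j => simp [hb, Fin.ext_iff]

/-! ### Sorted runs -/

/-- Arm `i` is plausible at the start and has not yet reached its exit after `n` pulls. -/
def Avail (i : Fin k) (n : ℕ) : Prop :=
  0 ≤ M.gain i 0 ∧ 0 ≤ M.σ (M.μ i) (M.genMean i n) - M.c i

variable {M}

theorem Avail.mono {i : Fin k} {m n : ℕ} (h : M.Avail i n) (hmn : m ≤ n) : M.Avail i m := by
  refine ⟨h.1, h.2.trans (sub_le_sub_right ?_ _)⟩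
  exact M.link_anti _ (M.mean_mem i) (M.genMean_mem i m.cast_nonneg)
    (M.genMean_mem i n.cast_nonneg) (M.genMean_mono i hmn)

theorem avail_of_gain_nonneg {i : Fin k} {x : Fin k → ℕ} (h : 0 ≤ M.gain i x) :
    M.Avail i (x i) := by
  refine ⟨h.trans (M.gain_le_gain i (M.top_mono fun _ => Nat.zero_le _)),
    h.trans (sub_le_sub_right ?_ _)⟩
  exact M.link_anti _ (M.mean_mem i) (M.genMean_mem i (x i).cast_nonneg) (M.top_mem x)
    (M.genMean_le_top i x)

theorem Avail.lt_exitPull (hM : M.HasExitPulls) {i : Fin k} {n : ℕ} (h : M.Avail i n) :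
    n < M.exitPull i := by
  by_contra! hc
  have h1 : M.ReachesExit i (M.exitPull i) := Nat.sInf_mem (hM i)
  exact absurd (h.mono hc).2 (not_le.2 h1.2)

theorem Avail.mem_plausible {i : Fin k} {n : ℕ} (h : M.Avail i n) : i ∈ M.plausible 0 := by
  have := h.1
  simp only [plausible, Finset.mem_filter, Finset.mem_univ, true_and]
  simpa [gain, top, Pi.zero_def] using this

variable (M)

/-- The entries of `w` before `T` are the pulls of the initially plausible arms up to their
exits, sorted by the generative mean to which they lead; entries after the last such pull are not
arms. -/
structure IsSortedRun (T : ℕ) (w : ℕ → ℕ) : Prop where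
  avail : ∀ t < T, ∀ i : Fin k, w t = i → M.Avail i (count w t i)
  le : ∀ t < T, ∀ j : Fin k, M.Avail j (count w t j) → ∃ i : Fin k, w t = i ∧
    M.genMean i ((count w t i + 1 : ℕ) : ℝ) ≤ M.genMean j ((count w t j + 1 : ℕ) : ℝ)

variable {M} {w : ℕ → ℕ}

theorem IsSortedRun.not_avail (hw : M.IsSortedRun T w) (hM : M.HasExitPulls)
    (hT : M.IsLongHorizon T) (j : Fin k) : ¬ M.Avail j (count w T j) := by
  intro hj
  have hlt : ∀ t < T, w t < k := fun t ht => by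
    obtain ⟨i, hi, -⟩ := hw.le t ht j (hj.mono (count_mono w ht.le j))
    rw [hi]
    exact i.2
  have hsum : ∀ t ≤ T, ∑ i : Fin k, count w t i = t := by
    intro t
    induction t with
    | zero => exact fun _ => Finset.sum_eq_zero fun i _ => occ_zero w i
    | succ t ih =>
      intro ht
      rw [count_succ_arm (i := ⟨w t, hlt t ht⟩) rfl]
      simp [Finset.sum_add_distrib, ih (by omega)]
  have hcount : ∀ t ≤ T, ∀ i : Fin k, count w t i ≤ if i ∈ M.plausible 0 then M.exitPull i else 0 := by
    intro t
    induction t with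
    | zero => exact fun _ i => (occ_zero w i).trans_le (Nat.zero_le _)
    | succ t ih =>
      intro ht i
      rw [count_succ]
      by_cases h : w t = i
      · have h1 := hw.avail t ht i h
        rw [if_pos h, if_pos h1.mem_plausible]
        exact h1.lt_exitPull hM
      · simpa [h] using ih (by omega) i
  have h1 : ∑ i : Fin k, count w T i < ∑ i : Fin k, if i ∈ M.plausible 0 then M.exitPull i else 0 := by
    refine Finset.sum_lt_sum (fun i _ => hcount T le_rfl i) ⟨j, Finset.mem_univ j, ?_⟩
    rw [if_pos hj.mem_plausible]
    exact hj.lt_exitPull hM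
  rw [hsum T le_rfl] at h1
  have h2 : ∑ i ∈ M.plausible 0, M.exitPull i ≤ T := hT
  rw [Finset.sum_ite_mem, Finset.univ_inter] at h1
  omega

/-- In a sorted run, an available arm is pulled later on. -/
theorem IsSortedRun.exists_isNext (hw : M.IsSortedRun T w) (hM : M.HasExitPulls)
    (hT : M.IsLongHorizon T) {t : ℕ} (ht : t ≤ T) {j : Fin k} (hj : M.Avail j (count w t j)) :
    ∃ t' ≤ T, IsNext w t j t' := by
  classical
  have hex : ∃ s, t ≤ s ∧ s < T ∧ w s = j := by
    by_contra! hc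
    refine hw.not_avail hM hT j ?_
    have : count w T j = count w t j := occ_eq_of_forall_ne ht hc
    rwa [this]
  obtain ⟨h1, h2, h3⟩ := Nat.find_spec hex
  refine ⟨Nat.find hex + 1, h2, by omega, h3, fun s hs hs' hj => ?_⟩
  exact Nat.find_min hex (by omega : s < Nat.find hex) ⟨hs, by omega, hj⟩

theorem IsSortedRun.top_eq (hw : M.IsSortedRun T w) {t t' : ℕ} {j : Fin k}
    (h : IsNext w t j t') (ht' : t' ≤ T) :
    M.top (count w t + Pi.single j 1) = M.top (count w t') := by
  have hlt := h.lt
  refine le_antisymm (M.top_mono (count_add_single_le h.eq hlt)) ?_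
  suffices ∀ s, t ≤ s → s ≤ t' → M.top (count w s) ≤ M.top (count w t + Pi.single j 1) from
    this t' hlt.le le_rfl
  intro s hs
  induction s, hs using Nat.le_induction with
  | base => exact fun _ => M.top_mono (by simp)
  | succ s hs ih =>
    intro hs'
    have hav : M.Avail j (count w s j) := by
      have := hw.avail (t' - 1) (by omega) j h.eq
      rwa [h.count_eq (by omega) (by omega), ← h.count_eq hs hs'] at this
    obtain ⟨i, hi, hle⟩ := hw.le s (by omega) j hav
    rw [count_succ_arm hi, top_add_single]
    refine max_le (ih (by omega)) (hle.trans ?_)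
    rw [h.count_eq hs hs', top_add_single]
    exact le_max_right _ _

/-! ### The dynamic program -/

variable (M)

/-- What the pulls in the first `t` entries of `w` would give if they were made with the top mean
that is reached after `t'` entries, negative gains being skipped. -/
def credit (w : ℕ → ℕ) (t t' : ℕ) : ℝ :=
  ∑ i : Fin k, (count w t i : ℝ) * M.posGain i (count w t')

theorem credit_succ_arm {t t' : ℕ} {i : Fin k} (h : w t = i) :
    M.credit w (t + 1) t' = M.credit w t t' + M.posGain i (count w t') := by
  have : ∀ j, ((count w (t + 1) j : ℕ) : ℝ) * M.posGain j (count w t') =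
      (count w t j : ℝ) * M.posGain j (count w t') +
        if i = j then M.posGain j (count w t') else 0 := by
    intro j
    rw [count_succ, h]
    by_cases hj : i = j
    · subst hj
      simp
      ring
    · simp [hj, Fin.val_inj]
  rw [credit, Finset.sum_congr rfl fun j _ => this j, Finset.sum_add_distrib]
  simp [credit]

theorem credit_succ_none {t t' : ℕ} (h : ¬ w t < k) :
    M.credit w (t + 1) t' = M.credit w t t' := by
  simp only [credit, count_succ_none h]

/-- The value of pulling `j` after `t` entries of the sorted run `w`, then all that lies
before `t'`, and continuing from there. -/
def candidate (w : ℕ → ℕ) (U : ℕ → ℝ) (t : ℕ) (j : Fin k) (t' : ℕ) : ℝ :=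
  M.posGain j (count w t) - M.posGain j (count w t') + (U t' - M.credit w t t')

/-- From index `a` on, `U` solves the Bellman equation for the sorted run `w`, and `succ` is an optimal choice;
`succ t = 0` means to stop. The value after `t` entries is `U t - credit w t t`. -/
structure IsBellman (a T : ℕ) (w : ℕ → ℕ) (U : ℕ → ℝ) (succ : ℕ → ℕ) : Prop where
  last : U T = M.credit w T T
  nonneg : ∀ t < T, a ≤ t → M.credit w t t ≤ U t
  upper : ∀ t < T, a ≤ t → ∀ j : Fin k, ∀ t' ≤ T, IsNext w t j t' →
    M.candidate w U t j t' ≤ U t - M.credit w t t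
  attained : ∀ t < T, a ≤ t → (succ t = 0 ∧ U t = M.credit w t t) ∨
    ∃ j : Fin k, IsNext w t j (succ t) ∧ succ t ≤ T ∧
      U t - M.credit w t t = M.candidate w U t j (succ t)

variable {M} {U : ℕ → ℝ} {succ : ℕ → ℕ}

theorem IsBellman.opt_le (hU : M.IsBellman 0 T w U succ) (hw : M.IsSortedRun T w)
    (hM : M.HasExitPulls) (hT : M.IsLongHorizon T) (n : ℕ) {t : ℕ} (ht : t ≤ T) :
    M.opt n (count w t) ≤ U t - M.credit w t t := by
  induction n generalizing t with
  | zero =>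
    rw [opt, sub_nonneg]
    rcases ht.lt_or_eq with h | rfl
    · exact hU.nonneg t h t.zero_le
    · exact hU.last.ge
  | succ n ih =>
    refine M.opt_succ_le (ih ht) fun j => ?_
    by_cases hj : 0 ≤ M.gain j (count w t)
    · obtain ⟨t', ht', hn⟩ := hw.exists_isNext hM hT ht (avail_of_gain_nonneg hj)
      have h1 := hU.upper t (hn.lt.trans_le ht') t.zero_le j t' ht' hn
      have h2 := M.opt_le_of_top_eq n (count_add_single_le hn.eq hn.lt) (hw.top_eq hn ht')
      have h3 := ih ht'
      have h4 : M.posGain j (count w t) = M.gain j (count w t) := max_eq_left hj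
      have h5 : ∑ i, ((count w t' i : ℝ) - ((count w t + Pi.single j 1 : Fin k → ℕ) i : ℕ)) *
          M.posGain i (count w t') =
          M.credit w t' t' - M.credit w t t' - M.posGain j (count w t') := by
        have : ∀ i, ((count w t' i : ℝ) - ((count w t + Pi.single j 1 : Fin k → ℕ) i : ℕ)) *
            M.posGain i (count w t') =
            (count w t' i : ℝ) * M.posGain i (count w t') -
            (count w t i : ℝ) * M.posGain i (count w t') -
            if j = i then M.posGain i (count w t') else 0 := by
          intro i
          by_cases h : j = i
          · subst h
            simp
            ring
          · simp [h, Ne.symm h]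
            ring
        rw [Finset.sum_congr rfl fun i _ => this i, Finset.sum_sub_distrib,
          Finset.sum_sub_distrib]
        simp [credit]
      simp only [candidate] at h1
      linarith
    · have h1 := M.opt_anti n (x := count w t) (x' := count w t + Pi.single j 1) (by simp)
      have := ih ht
      linarith

end Competition

namespace Competition

variable {k T : ℕ} [NeZero k] (M : Competition k)

/-- The entry `o` pulls `i` if this has non-negative gain when the pulls are `x`, and opts out
otherwise. -/
def Emits (i : ℕ) (x : Fin k → ℕ) (o : ℕ) : Prop :=
  (o = i ∧ ∀ j : Fin k, i = j → 0 ≤ M.gain j x) ∨ (o = k ∧ ∀ j : Fin k, i = j → M.gain j x < 0)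

variable {M} {w out : ℕ → ℕ} {s : ℕ} {x : Fin k → ℕ}

theorem Emits.posGain_le {i : Fin k} (h : M.Emits i x (out s))
    (hx : M.top (count out s) ≤ M.top x) :
    M.util out s + M.posGain i x ≤ M.util out (s + 1) := by
  rcases h with ⟨h, h'⟩ | ⟨h, h'⟩
  · rw [M.util_succ_arm h, posGain, max_eq_left (h' i rfl)]
    gcongr
    exact M.gain_le_gain i hx
  · rw [M.util_succ_none (by omega), posGain, max_eq_right (h' i rfl).le, add_zero]

theorem Emits.count_le {i : Fin k} (h : M.Emits i x (out s)) :
    count out (s + 1) ≤ count out s + Pi.single i 1 := by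
  rcases h with ⟨h, -⟩ | ⟨h, -⟩
  · rw [count_succ_arm h]
  · rw [count_succ_none (by omega)]
    simp

theorem Emits.none {i : ℕ} (hi : ¬ i < k) (h : M.Emits i x (out s)) : ¬ out s < k := by
  rcases h with ⟨h, -⟩ | ⟨h, -⟩ <;> omega

variable (M)

/-- State of the output after `s` rounds: `v` is the value to be collected, and `r` the end of
the current stretch of the sorted run `w`, all of which is pulled against the top mean after
`r` entries except that its last entry came first. -/
def OutputInv (T : ℕ) (w : ℕ → ℕ) (U : ℕ → ℝ) (v : ℝ) (out : ℕ → ℕ) (r s : ℕ) : Prop :=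
  (s = r ∧ (count out s : Fin k → ℕ) ≤ count w s ∧
    v ≤ M.util out s + (U s - M.credit w s s)) ∨
  (s < r ∧ r ≤ T ∧ 0 < s ∧ ∃ j : Fin k, w (r - 1) = j ∧
    count out s ≤ count w (s - 1) + Pi.single j 1 ∧
    v ≤ M.util out s + (U r - M.credit w (s - 1) r - M.posGain j (count w r))) ∨
  (r < s ∧ v ≤ M.util out s)

variable {M} {U : ℕ → ℝ} {succ : ℕ → ℕ} {v : ℝ} {r : ℕ}

theorem OutputInv.congr {out' : ℕ → ℕ} (h : M.OutputInv T w U v out r s)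
    (ho : ∀ t < s, out t = out' t) : M.OutputInv T w U v out' r s := by
  unfold OutputInv at h ⊢
  rwa [← M.util_congr ho, ← count_congr ho]

theorem OutputInv.start (hU : M.IsBellman 0 T w U succ) (h : M.OutputInv T w U v out s s)
    (hs : s < T) (h0 : succ s = 0 → ¬ out s < k)
    (he : succ s ≠ 0 → M.Emits (w (succ s - 1)) (count w s) (out s)) :
    M.OutputInv T w U v out (succ s) (s + 1) := by
  have h' : (count out s : Fin k → ℕ) ≤ count w s ∧
      v ≤ M.util out s + (U s - M.credit w s s) := by
    rcases h with ⟨-, h⟩ | ⟨h, -⟩ | ⟨h, -⟩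
    · exact h
    · omega
    · omega
  obtain ⟨h1, h2⟩ := h'
  rcases hU.attained s hs s.zero_le with ⟨hz, hv⟩ | ⟨j, hn, hT, hv⟩
  · right; right
    refine ⟨by omega, ?_⟩
    rw [M.util_succ_none (h0 hz)]
    linarith
  · have hlt := hn.lt
    have he := he (by omega)
    rw [hn.eq] at he
    have h3 := he.posGain_le (M.top_mono h1)
    have h4 : count out (s + 1) ≤ count w s + Pi.single j 1 :=
      he.count_le.trans (add_le_add_left h1 _)
    simp only [candidate] at hv
    rcases Nat.lt_or_ge (s + 1) (succ s) with hlt' | hge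
    · right; left
      refine ⟨hlt', hT, by omega, j, hn.eq, h4, ?_⟩
      rw [Nat.add_sub_cancel]
      linarith
    · left
      have heq : succ s = s + 1 := by omega
      have hj := hn.eq
      rw [heq, Nat.add_sub_cancel] at hj
      rw [count_succ_arm hj, M.credit_succ_arm hj, ← count_succ_arm hj]
      rw [← count_succ_arm hj] at h4
      rw [heq] at hv
      exact ⟨heq.symm, h4, by linarith⟩

theorem OutputInv.continue (h : M.OutputInv T w U v out r s) (hr : s < r)
    (he : M.Emits (w (s - 1)) (count w r) (out s)) : M.OutputInv T w U v out r (s + 1) := by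
  rcases h with ⟨h, -⟩ | ⟨-, hT, h0, j, hj, h1, h2⟩ | ⟨h, -⟩
  · omega
  · have hs : s - 1 + 1 = s := by omega
    have h3 : M.top (count out s) ≤ M.top (count w r) :=
      M.top_mono (h1.trans (count_add_single_le hj (by omega)))
    have h4 : count out (s + 1) ≤ count w s + Pi.single j 1 ∧
        v ≤ M.util out (s + 1) + (U r - M.credit w s r - M.posGain j (count w r)) := by
      by_cases hi : w (s - 1) < k
      · have hi' : w (s - 1) = (⟨w (s - 1), hi⟩ : Fin k) := rfl
        have h5 := count_succ_arm hi'
        have h6 := M.credit_succ_arm hi' (t' := r)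
        rw [hi'] at he
        have h7 := he.posGain_le h3
        rw [hs] at h5 h6
        refine ⟨?_, by linarith⟩
        rw [h5, add_right_comm]
        exact he.count_le.trans (add_le_add_left h1 _)
      · have h5 := count_succ_none hi
        have h6 := M.credit_succ_none hi (t' := r)
        have h7 := he.none hi
        rw [hs] at h5 h6
        rw [count_succ_none h7, M.util_succ_none h7, h5, h6]
        exact ⟨h1, h2⟩
    rcases Nat.lt_or_ge (s + 1) r with hlt | hge
    · right; left
      exact ⟨hlt, hT, by omega, j, hj, h4⟩
    · left
      have heq : r = s + 1 := by omega
      subst heq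
      rw [Nat.add_sub_cancel] at hj
      rw [← count_succ_arm hj] at h4
      refine ⟨rfl, h4.1, ?_⟩
      rw [M.credit_succ_arm hj]
      linarith [h4.2]
  · omega

theorem OutputInv.finish (h : M.OutputInv T w U v out r s) (hr : r < s) (ho : ¬ out s < k) :
    M.OutputInv T w U v out r (s + 1) := by
  rcases h with ⟨h, -⟩ | ⟨h, -⟩ | ⟨-, h⟩
  · omega
  · omega
  · right; right
    rw [M.util_succ_none ho]
    exact ⟨by omega, h⟩

theorem OutputInv.le_util (h : M.OutputInv T w U v out r T) (hU : M.IsBellman 0 T w U succ) :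
    v ≤ M.util out T := by
  rcases h with ⟨-, -, h⟩ | ⟨h, h', -⟩ | ⟨-, h⟩
  · rw [hU.last] at h
    linarith
  · omega
  · exact h

end Competition

namespace RealRAM

theorem Store.setNat_nat (s : Store) (a i v b : ℕ) :
    (s.setNat a i v).nat b = if b = a then Function.update (s.nat a) i v else s.nat b := by
  by_cases h : b = a
  · subst h
    simp [Store.setNat]
  · simp [Store.setNat, h]

theorem Store.setNat_real (s : Store) (a i v : ℕ) : (s.setNat a i v).real = s.real := rfl

theorem Store.setReal_real (s : Store) (a i b : ℕ) (v : ℝ) :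
    (s.setReal a i v).real b = if b = a then Function.update (s.real a) i v else s.real b := by
  by_cases h : b = a
  · subst h
    simp [Store.setReal]
  · simp [Store.setReal, h]

theorem Store.setReal_nat (s : Store) (a i : ℕ) (v : ℝ) : (s.setReal a i v).nat = s.nat := rfl

/-- The number of arms or the horizon. -/
inductive Limit where
  | arms
  | horizon

def Limit.toNExp : Limit → NExp
  | arms => .arms
  | horizon => .horizon

def Limit.val (k T : ℕ) : Limit → ℕ
  | arms => k
  | horizon => T

/-- Programs whose loops run a counter, the entry `0` of the natural-number array `c`, from `0`
up to a limit. -/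
inductive Code where
  | skip
  | setNat (a : ℕ) (i e : NExp)
  | setReal (a : ℕ) (i : NExp) (e : RExp)
  | seq (p q : Code)
  | cond (b : BExp) (p q : Code)
  | count (c : ℕ) (l : Limit) (p : Code)

namespace Code

def compile : Code → Prog
  | skip => .skip
  | setNat a i e => .setNat a i e
  | setReal a i e => .setReal a i e
  | seq p q => .seq p.compile q.compile
  | cond b p q => .cond b p.compile q.compile
  | count c l p => .seq (.setNat c (.lit 0) (.lit 0))
      (.loop (.natLe (.add (.get c (.lit 0)) (.lit 1)) l.toNExp)
        (.seq p.compile (.setNat c (.lit 0) (.add (.get c (.lit 0)) (.lit 1)))))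

/-- A bound for the number of steps. -/
def cost (k T : ℕ) : Code → ℕ
  | skip => 1
  | setNat _ i e => i.steps + e.steps + 1
  | setReal _ i e => i.steps + e.steps + 1
  | seq p q => p.cost k T + q.cost k T
  | cond b p q => b.steps + (p.cost k T + q.cost k T) + 1
  | count _ l p => l.val k T * (p.cost k T + 13) + 10

/-- The natural-number arrays that are written. -/
def natWrites : Code → List ℕ
  | skip => []
  | setNat a _ _ => [a]
  | setReal _ _ _ => []
  | seq p q => p.natWrites ++ q.natWrites
  | cond _ p q => p.natWrites ++ q.natWrites
  | count c _ p => c :: p.natWrites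

/-- The real arrays that are written. -/
def realWrites : Code → List ℕ
  | skip => []
  | setNat _ _ _ => []
  | setReal a _ _ => [a]
  | seq p q => p.realWrites ++ q.realWrites
  | cond _ p q => p.realWrites ++ q.realWrites
  | count _ _ p => p.realWrites

/-- No loop body writes the counter of the loop. -/
def CountersSafe : Code → Prop
  | skip => True
  | setNat _ _ _ => True
  | setReal _ _ _ => True
  | seq p q => p.CountersSafe ∧ q.CountersSafe
  | cond _ p q => p.CountersSafe ∧ q.CountersSafe
  | count c _ p => c ∉ p.natWrites ∧ p.CountersSafe

variable {k : ℕ} (M : Competition k) (T : ℕ)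

open Classical in
/-- The memory after a run. -/
def run : Code → Store → Store
  | skip, s => s
  | setNat a i e, s => s.setNat a (i.eval k T s) (e.eval k T s)
  | setReal a i e, s => s.setReal a (i.eval k T s) (e.eval M T s)
  | seq p q, s => q.run (p.run s)
  | cond b p q, s => if b.Holds M T s then p.run s else q.run s
  | count c l p, s => Nat.rec (s.setNat c 0 0) (fun i s' => (p.run s').setNat c 0 (i + 1))
      (l.val k T)

theorem run_setNat (a : ℕ) (i e : NExp) (s : Store) :
    (setNat a i e).run M T s = s.setNat a (i.eval k T s) (e.eval k T s) := rfl

theorem run_setReal (a : ℕ) (i : NExp) (e : RExp) (s : Store) :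
    (setReal a i e).run M T s = s.setReal a (i.eval k T s) (e.eval M T s) := rfl

theorem run_skip (s : Store) : skip.run M T s = s := rfl

theorem run_seq (p q : Code) (s : Store) : (seq p q).run M T s = q.run M T (p.run M T s) := rfl

theorem run_cond_of_holds {b : BExp} (p q : Code) {s : Store} (h : b.Holds M T s) :
    (cond b p q).run M T s = p.run M T s := if_pos h

theorem run_cond_of_not_holds {b : BExp} (p q : Code) {s : Store} (h : ¬ b.Holds M T s) :
    (cond b p q).run M T s = q.run M T s := if_neg h

theorem run_nat (p : Code) (s : Store) {a : ℕ} (h : a ∉ p.natWrites) :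
    (p.run M T s).nat a = s.nat a := by
  induction p generalizing s with
  | skip => rfl
  | setNat b i e =>
    have h : a ≠ b := by simpa [natWrites] using h
    simp [run, Store.setNat_nat, h]
  | setReal b i e => rfl
  | seq p q hp hq =>
    simp only [natWrites, List.mem_append, not_or] at h
    rw [run_seq, hq _ h.2, hp _ h.1]
  | cond b p q hp hq =>
    simp only [natWrites, List.mem_append, not_or] at h
    by_cases hb : b.Holds M T s
    · rw [run_cond_of_holds M T p q hb, hp _ h.1]
    · rw [run_cond_of_not_holds M T p q hb, hq _ h.2]
  | count c l p hp =>
    simp only [natWrites, List.mem_cons, not_or] at h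
    rw [run]
    induction l.val k T with
    | zero => simp [Store.setNat_nat, h.1]
    | succ n ih => simp only [Store.setNat_nat, h.1, if_false, hp _ h.2, ih]

theorem run_real (p : Code) (s : Store) {a : ℕ} (h : a ∉ p.realWrites) :
    (p.run M T s).real a = s.real a := by
  induction p generalizing s with
  | skip => rfl
  | setNat b i e => rfl
  | setReal b i e =>
    have h : a ≠ b := by simpa [realWrites] using h
    simp [run, Store.setReal_real, h]
  | seq p q hp hq =>
    simp only [realWrites, List.mem_append, not_or] at h
    rw [run_seq, hq _ h.2, hp _ h.1]
  | cond b p q hp hq =>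
    simp only [realWrites, List.mem_append, not_or] at h
    by_cases hb : b.Holds M T s
    · rw [run_cond_of_holds M T p q hb, hp _ h.1]
    · rw [run_cond_of_not_holds M T p q hb, hq _ h.2]
  | count c l p hp =>
    simp only [realWrites] at h
    rw [run]
    induction l.val k T with
    | zero => simp [Store.setNat_real]
    | succ n ih => simp only [Store.setNat_real, hp _ h, ih]

/-- Verification of a loop by an invariant. -/
theorem run_count {c : ℕ} (l : Limit) {p : Code} (I : ℕ → Store → Prop)
    {s : Store} (h0 : I 0 (s.setNat c 0 0))
    (hI : ∀ i < l.val k T, ∀ s, s.nat c 0 = i → I i s →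
      I (i + 1) ((p.run M T s).setNat c 0 (i + 1))) :
    I (l.val k T) ((count c l p).run M T s) := by
  rw [run]
  suffices ∀ n ≤ l.val k T, ∀ s' : Store,
      s' = Nat.rec (s.setNat c 0 0) (fun i s' => (p.run M T s').setNat c 0 (i + 1)) n →
      s'.nat c 0 = n ∧ I n s' from (this _ le_rfl _ rfl).2
  intro n
  induction n with
  | zero =>
    rintro - s' rfl
    exact ⟨by simp [Store.setNat_nat], h0⟩
  | succ n ih =>
    rintro hn s' rfl
    obtain ⟨h1, h2⟩ := ih (by omega) _ rfl
    exact ⟨by simp [Store.setNat_nat], hI n (by omega) _ h1 h2⟩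

theorem exists_exec (p : Code) (hp : p.CountersSafe) (s : Store) :
    ∃ n ≤ p.cost k T, Exec M T p.compile s n (p.run M T s) := by
  induction p generalizing s with
  | skip => exact ⟨_, le_rfl, .skip s⟩
  | setNat a i e => exact ⟨_, le_rfl, .setNat a i e s⟩
  | setReal a i e => exact ⟨_, le_rfl, .setReal a i e s⟩
  | seq p q ihp ihq =>
    obtain ⟨m, hm, hpe⟩ := ihp hp.1 s
    obtain ⟨n, hn, hqe⟩ := ihq hp.2 (p.run M T s)
    exact ⟨m + n, Nat.add_le_add hm hn, .seq hpe hqe⟩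
  | cond b p q ihp ihq =>
    by_cases hb : b.Holds M T s
    · obtain ⟨m, hm, hpe⟩ := ihp hp.1 s
      refine ⟨b.steps + m + 1, ?_, ?_⟩
      · simp only [cost]
        omega
      · rw [run_cond_of_holds M T p q hb]
        exact .cond_true hb hpe
    · obtain ⟨m, hm, hqe⟩ := ihq hp.2 s
      refine ⟨b.steps + m + 1, ?_, ?_⟩
      · simp only [cost]
        omega
      · rw [run_cond_of_not_holds M T p q hb]
        exact .cond_false hb hqe
  | count c l p ih =>
    have hl : ∀ s, l.toNExp.eval k T s = l.val k T := by
      intro s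
      cases l <;> rfl
    have hls : l.toNExp.steps = 1 := by cases l <;> rfl
    have key : ∀ d n, n + d = l.val k T → ∀ s' : Store, s'.nat c 0 = n →
        s' = Nat.rec (s.setNat c 0 0) (fun i s' => (p.run M T s').setNat c 0 (i + 1)) n →
        ∃ m ≤ d * (p.cost k T + 13) + 7,
          Exec M T (.loop (.natLe (.add (.get c (.lit 0)) (.lit 1)) l.toNExp)
            (.seq p.compile (.setNat c (.lit 0) (.add (.get c (.lit 0)) (.lit 1))))) s' m
            ((count c l p).run M T s) := by
      intro d
      induction d with
      | zero =>
        intro n hn s' hs' hs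
        have : s' = (count c l p).run M T s := by
          rw [hs, run, ← hn, Nat.add_zero]
        rw [← this]
        refine ⟨_, ?_, .loop_done ?_⟩
        · simp [BExp.steps, NExp.steps, hls]
        · simp only [BExp.Holds, NExp.eval, hl, hs']
          omega
      | succ d ihd =>
        intro n hn s' hs' hs
        obtain ⟨m, hm, hpe⟩ := ih hp.2 s'
        have h1 : (p.run M T s').nat c 0 = n := by rw [run_nat M T p s' hp.1, hs']
        obtain ⟨m', hm', hle⟩ := ihd (n + 1) (by omega) ((p.run M T s').setNat c 0 (n + 1))
          (by simp [Store.setNat_nat]) (by rw [hs])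
        have hset := Exec.setNat (M := M) (T := T) c (.lit 0)
          (.add (.get c (.lit 0)) (.lit 1)) (p.run M T s')
        simp only [NExp.eval, h1] at hset
        refine ⟨_, ?_, .loop_step ?_ (.seq hpe hset) hle⟩
        · simp only [BExp.steps, NExp.steps, hls]
          rw [Nat.add_mul, Nat.one_mul]
          omega
        · simp only [BExp.Holds, NExp.eval, hl, hs']
          omega
    obtain ⟨m, hm, hme⟩ := key _ 0 (Nat.zero_add _) (s.setNat c 0 0) (by simp [Store.setNat_nat])
      rfl
    refine ⟨_, ?_, .seq (.setNat c (.lit 0) (.lit 0) s) hme⟩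
    simp only [NExp.steps, cost]
    omega

end Code
end RealRAM

/-- For each arm, `nx` holds the next index after `t` that follows a pull of it in `w`, or `0` if
there is none up to `T`. -/
def NextSpec (k T : ℕ) (w : ℕ → ℕ) (t : ℕ) (nx : ℕ → ℕ) : Prop :=
  ∀ j < k, (nx j = 0 ∧ ∀ s, t ≤ s → s < T → w s ≠ j) ∨ (IsNext w t j (nx j) ∧ nx j ≤ T)

theorem NextSpec.step {k T : ℕ} {w nx : ℕ → ℕ} {t : ℕ} (h : NextSpec k T w (t + 1) nx)
    (ht : t < T) : NextSpec k T w t (Function.update nx (w t) (t + 1)) := by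
  intro j hj
  by_cases hw : w t = j
  · right
    rw [hw, Function.update_self]
    exact ⟨⟨by omega, hw, by omega⟩, ht⟩
  · rw [Function.update_of_ne (Ne.symm hw)]
    rcases h j hj with ⟨h1, h2⟩ | ⟨⟨h1, h2, h3⟩, h4⟩
    · refine Or.inl ⟨h1, fun s hs hs' => ?_⟩
      rcases hs.eq_or_lt with rfl | hs
      · exact hw
      · exact h2 s hs hs'
    · refine Or.inr ⟨⟨by omega, h2, fun s hs hs' => ?_⟩, h4⟩
      rcases hs.eq_or_lt with rfl | hs
      · exact hw
      · exact h3 s hs hs'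

theorem NextSpec.eq {k T : ℕ} {w nx : ℕ → ℕ} {t t' j : ℕ} (h : NextSpec k T w t nx)
    (hj : j < k) (hn : IsNext w t j t') (ht' : t' ≤ T) : nx j = t' := by
  have h1 := hn.lt
  rcases h j hj with ⟨h2, h3⟩ | ⟨h2, h3⟩
  · exact absurd hn.eq (h3 _ (by omega) (by omega))
  · have h4 := h2.lt
    rcases lt_trichotomy (nx j) t' with hlt | heq | hgt
    · exact absurd h2.eq (hn.ne _ (by omega) (by omega))
    · exact heq
    · exact absurd hn.eq (h2.ne _ (by omega) (by omega))

theorem NextSpec.le {k T : ℕ} {w nx : ℕ → ℕ} {t : ℕ} (h : NextSpec k T w t nx) (j : Fin k) :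
    nx j ≤ T := by
  rcases h j j.2 with ⟨h, -⟩ | ⟨-, h⟩ <;> omega

namespace RealRAM

/- Arrays of natural numbers; `OUT` is the output. -/
local notation "OUT" => (0 : ℕ)
local notation "ITEM" => (1 : ℕ)
local notation "CNT" => (2 : ℕ)
local notation "NEXT" => (3 : ℕ)
local notation "SUCC" => (4 : ℕ)
local notation "RND" => (5 : ℕ)
local notation "ARM" => (6 : ℕ)
local notation "AUX" => (7 : ℕ)
local notation "BEST" => (8 : ℕ)
local notation "TGT" => (9 : ℕ)
local notation "POS" => (10 : ℕ)
/- Arrays of real numbers. -/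
local notation "FIRST" => (0 : ℕ)
local notation "LAST" => (1 : ℕ)
local notation "TOP" => (2 : ℕ)
local notation "VAL" => (3 : ℕ)
local notation "SUM" => (4 : ℕ)
local notation "MAX" => (5 : ℕ)
local notation "CAND" => (6 : ℕ)
local notation "LEVEL" => (7 : ℕ)

/-- The entry `0` of an array of naturals. -/
def NExp.var (a : ℕ) : NExp := .get a (.lit 0)

/-- The entry `0` of an array of reals. -/
def RExp.var (a : ℕ) : RExp := .get a (.lit 0)

/-- The generative mean of arm `i` after `n` pulls. -/
def RExp.genMean (i n : NExp) : RExp := .sub (.askMean i) (.askGap i n)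

/-- The human's reward from arm `i` against the mean `y`. -/
def RExp.reward (i : NExp) (y : RExp) : RExp := .sub (.askLink (.askMean i) y) (.askCost i)

/-- The reward is non-negative. -/
def BExp.accepts (i : NExp) (y : RExp) : BExp := .realLe (.cast (.lit 0)) (.reward i y)

/-- Sums over all arms the count times the positive part of the reward against `LEVEL`. -/
def sumCode : Code :=
  .seq (.setReal SUM (.lit 0) (.cast (.lit 0))) <|
  .count AUX .arms <|
    .cond (.accepts (.var AUX) (.var LEVEL))
      (.setReal SUM (.lit 0) (.add (.var SUM)
        (.mul (.cast (.get CNT (.var AUX))) (.reward (.var AUX) (.var LEVEL)))))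
      .skip

/-- Computes the highest initial generative mean. -/
def startCode : Code :=
  .seq
    (.count ARM .arms <|
      .cond (.realLe (.genMean (.var ARM) (.lit 0)) (.var LAST)) .skip
        (.setReal LAST (.lit 0) (.genMean (.var ARM) (.lit 0))))
    (.setReal FIRST (.lit 0) (.var LAST))

/-- Selects the available arm whose next pull leads to the lowest generative mean. -/
def pickCode : Code :=
  .seq (.setNat BEST (.lit 0) .arms) <|
  .count ARM .arms <|
    .cond (.conj (.conj (.accepts (.var ARM) (.var FIRST))
          (.accepts (.var ARM) (.genMean (.var ARM) (.get CNT (.var ARM)))))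
        (.neg (.conj (.natLe (.add (.var BEST) (.lit 1)) .arms)
          (.realLe (.genMean (.var BEST) (.add (.get CNT (.var BEST)) (.lit 1)))
            (.genMean (.var ARM) (.add (.get CNT (.var ARM)) (.lit 1)))))))
      (.setNat BEST (.lit 0) (.var ARM))
      .skip

/-- Computes the sorted run. -/
def sortCode : Code :=
  .count RND .horizon <|
    .seq (.setReal TOP (.var RND) (.var LAST)) <|
    .seq pickCode <|
    .seq (.setNat ITEM (.var RND) (.var BEST)) <|
    .seq (.setNat CNT (.var BEST) (.add (.get CNT (.var BEST)) (.lit 1))) <|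
    .cond (.realLe (.genMean (.var BEST) (.get CNT (.var BEST))) (.var LAST)) .skip
      (.setReal LAST (.lit 0) (.genMean (.var BEST) (.get CNT (.var BEST))))

/-- Computes the value of the candidate `ARM`. -/
def candidateCode : Code :=
  .seq (.setReal LEVEL (.lit 0) (.get TOP (.get NEXT (.var ARM)))) <|
  .seq sumCode <|
  .seq (.setReal CAND (.lit 0) (.sub (.get VAL (.get NEXT (.var ARM))) (.var SUM))) <|
  .seq (.cond (.accepts (.var ARM) (.get TOP (.var POS)))
    (.setReal CAND (.lit 0)
      (.add (.var CAND) (.reward (.var ARM) (.get TOP (.var POS))))) .skip) <|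
  .cond (.accepts (.var ARM) (.var LEVEL))
    (.setReal CAND (.lit 0)
      (.sub (.var CAND) (.reward (.var ARM) (.var LEVEL)))) .skip

/-- Selects the best candidate. -/
def bestCode : Code :=
  .seq (.setReal MAX (.lit 0) (.cast (.lit 0))) <|
  .seq (.setNat SUCC (.var POS) (.lit 0)) <|
  .count ARM .arms <|
    .cond (.natLe (.lit 1) (.get NEXT (.var ARM)))
      (.seq candidateCode <|
        .cond (.realLe (.var MAX) (.var CAND))
          (.seq (.setReal MAX (.lit 0) (.var CAND))
            (.setNat SUCC (.var POS) (.get NEXT (.var ARM))))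
          .skip)
      .skip

/-- One step of the dynamic program. -/
def bellmanCode : Code :=
  .seq (.setNat POS (.lit 0) (.sub .horizon (.add (.var RND) (.lit 1)))) <|
  .seq (.setNat CNT (.get ITEM (.var POS)) (.sub (.get CNT (.get ITEM (.var POS))) (.lit 1))) <|
  .seq (.setNat NEXT (.get ITEM (.var POS)) (.add (.var POS) (.lit 1))) <|
  .seq bestCode <|
  .seq (.setReal LEVEL (.lit 0) (.get TOP (.var POS))) <|
  .seq sumCode <|
  .setReal VAL (.var POS) (.add (.var MAX) (.var SUM))

/-- Solves the Bellman equation backwards. -/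
def solveCode : Code :=
  .seq (.setReal TOP .horizon (.var LAST)) <|
  .seq (.setReal LEVEL (.lit 0) (.var LAST)) <|
  .seq sumCode <|
  .seq (.setReal VAL .horizon (.var SUM)) <|
  .count RND .horizon bellmanCode

/-- Writes the strategy. -/
def outputCode : Code :=
  .count RND .horizon <|
    .seq (.setNat OUT (.var RND) .arms) <|
    .cond (.conj (.natLe (.var RND) (.var TGT)) (.natLe (.var TGT) (.var RND)))
      (.seq (.setNat TGT (.lit 0) (.get SUCC (.var RND))) <|
        .cond (.conj (.natLe (.lit 1) (.var TGT))
            (.accepts (.get ITEM (.sub (.var TGT) (.lit 1))) (.get TOP (.var RND))))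
          (.setNat OUT (.var RND) (.get ITEM (.sub (.var TGT) (.lit 1))))
          .skip)
      (.cond (.conj (.natLe (.var RND) (.var TGT))
          (.accepts (.get ITEM (.sub (.var RND) (.lit 1))) (.get TOP (.var TGT))))
        (.setNat OUT (.var RND) (.get ITEM (.sub (.var RND) (.lit 1))))
        .skip)

/-- The whole algorithm. -/
def algorithm : Code := .seq startCode <| .seq sortCode <| .seq solveCode outputCode

theorem algorithm_countersSafe : algorithm.CountersSafe := by
  simp [algorithm, startCode, sortCode, pickCode, solveCode, bellmanCode, bestCode, candidateCode,
    sumCode, outputCode, Code.CountersSafe, Code.natWrites]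

theorem algorithm_cost_le (k T : ℕ) (hk : 0 < k) (hT : 0 < T) :
    algorithm.cost k T ≤ 1000 * (T * k ^ 3) := by
  have h1 : 1 ≤ T * k ^ 3 := Nat.succ_le_of_lt (by positivity)
  have h2 : k ≤ T * k ^ 3 := by
    calc k = 1 * k ^ 1 := by ring
      _ ≤ T * k ^ 3 := Nat.mul_le_mul hT (Nat.pow_le_pow_right hk (by norm_num))
  have h3 : T ≤ T * k ^ 3 := Nat.le_mul_of_pos_right T (by positivity)
  have h4 : T * k ≤ T * k ^ 3 := by
    calc T * k = T * k ^ 1 := by ring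
      _ ≤ T * k ^ 3 := Nat.mul_le_mul_left T (Nat.pow_le_pow_right hk (by norm_num))
  have h5 : T * k ^ 2 ≤ T * k ^ 3 :=
    Nat.mul_le_mul_left T (Nat.pow_le_pow_right hk (by norm_num))
  simp only [algorithm, startCode, sortCode, pickCode, solveCode, bellmanCode, bestCode,
    candidateCode, sumCode, outputCode, Code.cost, Limit.val, NExp.steps, RExp.steps, BExp.steps,
    NExp.var, RExp.var, RExp.genMean, RExp.reward, BExp.accepts]
  ring_nf
  linarith

section

variable {k : ℕ} (M : Competition k) (T : ℕ)

theorem NExp.eval_var (s : Store) (a : ℕ) : (NExp.var a).eval k T s = s.nat a 0 := rfl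

theorem RExp.eval_var (s : Store) (a : ℕ) : (RExp.var a).eval M T s = s.real a 0 := rfl

variable {M T}

theorem RExp.eval_genMean {s : Store} {i n : NExp} {j : Fin k} (h : i.eval k T s = j) :
    (RExp.genMean i n).eval M T s = M.genMean j (n.eval k T s) := by
  simp [RExp.genMean, RExp.eval, h, Competition.genMean]

theorem RExp.eval_reward {s : Store} {i : NExp} {y : RExp} {j : Fin k} (h : i.eval k T s = j) :
    (RExp.reward i y).eval M T s = M.σ (M.μ j) (y.eval M T s) - M.c j := by
  simp [RExp.reward, RExp.eval, h]

theorem BExp.holds_accepts {s : Store} {i : NExp} {y : RExp} {j : Fin k}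
    (h : i.eval k T s = j) :
    (BExp.accepts i y).Holds M T s ↔ 0 ≤ M.σ (M.μ j) (y.eval M T s) - M.c j := by
  rw [BExp.accepts, BExp.Holds, RExp.eval_reward h]
  simp [RExp.eval, NExp.eval]

theorem sumCode_run (s : Store) : (sumCode.run M T s).real SUM 0 =
    ∑ i : Fin k, (s.nat CNT i : ℝ) * max (M.σ (M.μ i) (s.real LEVEL 0) - M.c i) 0 := by
  set f : ℕ → ℝ := fun i => if h : i < k then
    (s.nat CNT i : ℝ) * max (M.σ (M.μ ⟨i, h⟩) (s.real LEVEL 0) - M.c ⟨i, h⟩) 0 else 0 with hf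
  have hsum : ∑ i : Fin k, (s.nat CNT i : ℝ) * max (M.σ (M.μ i) (s.real LEVEL 0) - M.c i) 0 =
      ∑ i ∈ Finset.range k, f i := by
    rw [Finset.sum_range]
    simp [hf]
  rw [hsum, sumCode, Code.run_seq]
  refine (Code.run_count M T .arms (fun i s' => s'.nat CNT = s.nat CNT ∧
    s'.real LEVEL = s.real LEVEL ∧ s'.real SUM 0 = ∑ i ∈ Finset.range i, f i) ?_ ?_).2.2
  · simp [Code.run, Store.setNat_nat, Store.setNat_real, Store.setReal_nat, Store.setReal_real,
      RExp.eval, NExp.eval]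
  · rintro i hi s' hc ⟨h1, h2, h3⟩
    have hi : i < k := hi
    have he : (NExp.var AUX).eval k T s' = (⟨i, hi⟩ : Fin k) := hc
    have hfi : f i = (s.nat CNT i : ℝ) *
        max (M.σ (M.μ ⟨i, hi⟩) (s.real LEVEL 0) - M.c ⟨i, hi⟩) 0 := by simp [hf, hi]
    by_cases hb : (BExp.accepts (.var AUX) (.var LEVEL)).Holds M T s'
    · rw [Code.run_cond_of_holds _ _ _ _ hb]
      rw [BExp.holds_accepts he, RExp.eval_var, h2] at hb
      simp [Code.run, Store.setNat_nat, Store.setNat_real, Store.setReal_nat,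
        Store.setReal_real, RExp.eval, NExp.eval, RExp.eval_reward he, RExp.eval_var, hc,
        NExp.eval_var, h1, h2, h3, Finset.sum_range_succ, hfi, max_eq_left hb]
    · rw [Code.run_cond_of_not_holds _ _ _ _ hb]
      rw [BExp.holds_accepts he, RExp.eval_var, h2, not_le] at hb
      simp [Code.run, Store.setNat_nat, Store.setNat_real, h1, h2, h3, Finset.sum_range_succ, hfi,
        max_eq_right hb.le]

end

variable {k : ℕ} [NeZero k] {M : Competition k} {T : ℕ}

theorem sumCode_run_eq_credit {s : Store} {w : ℕ → ℕ} {t t' : ℕ} (hc : s.nat CNT = occ w t)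
    (hl : s.real LEVEL 0 = M.top (Competition.count w t')) :
    (sumCode.run M T s).real SUM 0 = M.credit w t t' := by
  rw [sumCode_run, hc, hl]
  rfl

theorem startCode_run (s : Store) (hs : s.real LAST 0 = 0) :
    (startCode.run M T s).real LAST 0 = M.top 0 ∧ (startCode.run M T s).real FIRST 0 = M.top 0 := by
  have hinv := Code.run_count M T .arms (c := ARM) (s := s)
    (p := .cond (.realLe (.genMean (.var ARM) (.lit 0)) (.var LAST)) .skip
        (.setReal LAST (.lit 0) (.genMean (.var ARM) (.lit 0))))
    (fun i s' => s'.real LAST 0 ≤ M.top 0 ∧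
      ∀ j : Fin k, j < i → M.genMean j ((0 : ℕ) : ℝ) ≤ s'.real LAST 0) ?_ ?_
  · have h : ∀ s' : Store, (s'.real LAST 0 ≤ M.top 0 ∧
        ∀ j : Fin k, j < k → M.genMean j ((0 : ℕ) : ℝ) ≤ s'.real LAST 0) →
        s'.real LAST 0 = M.top 0 := fun s' h =>
      le_antisymm h.1 (M.top_le_iff.2 fun j => h.2 j j.2)
    have h := h _ hinv
    rw [startCode, Code.run_seq, Code.run_setReal]
    simp only [Store.setReal_real, RExp.eval_var, NExp.eval]
    simpa using h
  · refine ⟨?_, by simp⟩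
    rw [Store.setNat_real, hs]
    exact M.low_nonneg.trans (M.top_mem 0).1
  · rintro i hi s' hc ⟨h1, h2⟩
    have hi : i < k := hi
    have he : (NExp.var ARM).eval k T s' = (⟨i, hi⟩ : Fin k) := hc
    have hstep : ∀ v : ℝ, v = max (s'.real LAST 0) (M.genMean ⟨i, hi⟩ ((0 : ℕ) : ℝ)) →
        v ≤ M.top 0 ∧ ∀ j : Fin k, j < i + 1 → M.genMean j ((0 : ℕ) : ℝ) ≤ v := by
      rintro v rfl
      refine ⟨max_le h1 (M.genMean_le_top ⟨i, hi⟩ 0), fun j hj => ?_⟩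
      rcases (Nat.lt_succ_iff.1 hj).lt_or_eq with hj | rfl
      · exact (h2 j hj).trans (le_max_left _ _)
      · exact le_max_right _ _
    rw [Store.setNat_real]
    apply hstep
    by_cases hb : (BExp.realLe (.genMean (.var ARM) (.lit 0)) (.var LAST)).Holds M T s'
    · rw [Code.run_cond_of_holds _ _ _ _ hb]
      rw [BExp.Holds, RExp.eval_genMean he] at hb
      exact (max_eq_left hb).symm
    · rw [Code.run_cond_of_not_holds _ _ _ _ hb]
      rw [BExp.Holds, RExp.eval_genMean he, not_le] at hb
      refine Eq.trans ?_ (max_eq_right hb.le).symm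
      simp [Code.run, Store.setReal_real, RExp.eval_genMean he, NExp.eval]

/-- Invariant of `sortCode`. -/
structure SortInv (M : Competition k) (t : ℕ) (s : Store) : Prop where
  run : M.IsSortedRun t (s.nat ITEM)
  cnt : s.nat CNT = occ (s.nat ITEM) t
  last : s.real LAST 0 = M.top (Competition.count (s.nat ITEM) t)
  first : s.real FIRST 0 = M.top 0
  top : ∀ r < t, s.real TOP r = M.top (Competition.count (s.nat ITEM) r)

theorem pickCode_run {s : Store} {x : Fin k → ℕ} (hx : ∀ i : Fin k, s.nat CNT i = x i)
    (hf : s.real FIRST 0 = M.top 0) :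
    (∀ i : Fin k, (pickCode.run M T s).nat BEST 0 = i → M.Avail i (x i)) ∧
    ∀ j : Fin k, M.Avail j (x j) → ∃ i : Fin k, (pickCode.run M T s).nat BEST 0 = i ∧
      M.genMean i ((x i + 1 : ℕ) : ℝ) ≤ M.genMean j ((x j + 1 : ℕ) : ℝ) := by
  rw [pickCode, Code.run_seq]
  have hinv := Code.run_count M T .arms (c := ARM)
    (s := (Code.setNat BEST (.lit 0) .arms).run M T s)
    (p := .cond (.conj (.conj (.accepts (.var ARM) (.var FIRST))
          (.accepts (.var ARM) (.genMean (.var ARM) (.get CNT (.var ARM)))))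
        (.neg (.conj (.natLe (.add (.var BEST) (.lit 1)) .arms)
          (.realLe (.genMean (.var BEST) (.add (.get CNT (.var BEST)) (.lit 1)))
            (.genMean (.var ARM) (.add (.get CNT (.var ARM)) (.lit 1)))))))
      (.setNat BEST (.lit 0) (.var ARM))
      .skip)
    (fun n s' => s'.nat CNT = s.nat CNT ∧ s'.real FIRST = s.real FIRST ∧
      (∀ i : Fin k, s'.nat BEST 0 = i → M.Avail i (x i)) ∧
      ∀ j : Fin k, j < n → M.Avail j (x j) → ∃ i : Fin k, s'.nat BEST 0 = i ∧
        M.genMean i ((x i + 1 : ℕ) : ℝ) ≤ M.genMean j ((x j + 1 : ℕ) : ℝ)) ?_ ?_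
  · exact ⟨hinv.2.2.1, fun j hj => hinv.2.2.2 j j.2 hj⟩
  · simp only [Code.run, Store.setNat_nat, Store.setNat_real, NExp.eval]
    refine ⟨by simp, trivial, fun i hi => ?_, by simp⟩
    simp at hi
    exact absurd hi i.2.ne'
  · rintro n hn s' hc ⟨h1, h2, h3, h4⟩
    have hn : n < k := hn
    have he : (NExp.var ARM).eval k T s' = (⟨n, hn⟩ : Fin k) := hc
    have hav : (BExp.conj (.accepts (.var ARM) (.var FIRST))
        (.accepts (.var ARM) (.genMean (.var ARM) (.get CNT (.var ARM))))).Holds M T s' ↔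
        M.Avail ⟨n, hn⟩ (x ⟨n, hn⟩) := by
      rw [BExp.Holds, BExp.holds_accepts he, BExp.holds_accepts he, RExp.eval_genMean he,
        RExp.eval_var, NExp.eval, he, h1, h2, hf, hx]
      rfl
    have hcmp : (BExp.conj (.natLe (.add (.var BEST) (.lit 1)) .arms)
          (.realLe (.genMean (.var BEST) (.add (.get CNT (.var BEST)) (.lit 1)))
            (.genMean (.var ARM) (.add (.get CNT (.var ARM)) (.lit 1))))).Holds M T s' ↔
        ∃ i : Fin k, s'.nat BEST 0 = i ∧
          M.genMean i ((x i + 1 : ℕ) : ℝ) ≤ M.genMean ⟨n, hn⟩ ((x ⟨n, hn⟩ + 1 : ℕ) : ℝ) := by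
      by_cases hb : s'.nat BEST 0 < k
      · have hb' : (NExp.var BEST).eval k T s' = (⟨s'.nat BEST 0, hb⟩ : Fin k) := rfl
        rw [BExp.Holds, BExp.Holds, BExp.Holds, RExp.eval_genMean he, RExp.eval_genMean hb']
        simp only [NExp.eval, he, hb', h1, ← hx]
        constructor
        · exact fun h => ⟨_, rfl, h.2⟩
        · rintro ⟨i, hi, h⟩
          have : i = ⟨s'.nat BEST 0, hb⟩ := Fin.ext hi.symm
          subst this
          exact ⟨hb, h⟩
      · constructor
        · intro h
          exact absurd h.1 (by simp [BExp.Holds, NExp.eval, NExp.eval_var]; omega)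
        · rintro ⟨i, hi, -⟩
          exact absurd i.2 (hi ▸ hb)
    simp only [Store.setNat_nat, Store.setNat_real]
    by_cases hb : (BExp.conj (.conj (.accepts (.var ARM) (.var FIRST))
          (.accepts (.var ARM) (.genMean (.var ARM) (.get CNT (.var ARM)))))
        (.neg (.conj (.natLe (.add (.var BEST) (.lit 1)) .arms)
          (.realLe (.genMean (.var BEST) (.add (.get CNT (.var BEST)) (.lit 1)))
            (.genMean (.var ARM) (.add (.get CNT (.var ARM)) (.lit 1))))))).Holds M T s'
    · rw [Code.run_cond_of_holds _ _ _ _ hb]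
      have hb1 := hav.1 hb.1
      have hb2 := fun h => hb.2 (hcmp.2 h)
      simp only [Code.run, Store.setNat_nat, Store.setNat_real, NExp.eval, he]
      refine ⟨by simpa using h1, h2, fun i hi => ?_, fun j hj hj' => ⟨⟨n, hn⟩, by simp, ?_⟩⟩
      · have : i = ⟨n, hn⟩ := Fin.ext (by simpa using hi.symm)
        rwa [this]
      · rcases (Nat.lt_succ_iff.1 hj).lt_or_eq with hj | rfl
        · obtain ⟨i, hi, hle⟩ := h4 j hj hj'
          refine le_trans ?_ hle
          by_contra! hc
          exact hb2 ⟨i, hi, hc.le⟩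
        · exact le_rfl
    · rw [Code.run_cond_of_not_holds _ _ _ _ hb]
      simp only [Code.run]
      refine ⟨by simpa using h1, h2, by simpa using h3, fun j hj hj' => ?_⟩
      rcases (Nat.lt_succ_iff.1 hj).lt_or_eq with hj | rfl
      · simpa using h4 j hj hj'
      · by_contra hc
        refine hb ⟨hav.2 hj', fun h => hc ?_⟩
        simpa using hcmp.1 h

theorem _root_.Competition.IsSortedRun.snoc {w : ℕ → ℕ} {t b : ℕ} (h : M.IsSortedRun t w)
    (hb : ∀ i : Fin k, b = i → M.Avail i (Competition.count w t i))
    (hb' : ∀ j : Fin k, M.Avail j (Competition.count w t j) → ∃ i : Fin k, b = i ∧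
      M.genMean i ((Competition.count w t i + 1 : ℕ) : ℝ) ≤
        M.genMean j ((Competition.count w t j + 1 : ℕ) : ℝ)) :
    M.IsSortedRun (t + 1) (Function.update w t b) := by
  have hw : ∀ s < t, Function.update w t b s = w s := fun s hs =>
    Function.update_of_ne (by omega) _ _
  have hc : ∀ s ≤ t, (Competition.count (Function.update w t b) s : Fin k → ℕ) =
      Competition.count w s := fun s hs => Competition.count_congr fun r hr => hw r (by omega)
  constructor
  · intro s hs
    rw [hc s (by omega)]
    rcases (Nat.lt_succ_iff.1 hs).lt_or_eq with hs | rfl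
    · rw [hw s hs]
      exact h.avail s hs
    · rwa [Function.update_self]
  · intro s hs
    rw [hc s (by omega)]
    rcases (Nat.lt_succ_iff.1 hs).lt_or_eq with hs | rfl
    · rw [hw s hs]
      exact h.le s hs
    · rwa [Function.update_self]

theorem _root_.occ_update_succ (w : ℕ → ℕ) (t b : ℕ) :
    occ (Function.update w t b) (t + 1) = Function.update (occ w t) b (occ w t b + 1) := by
  funext i
  rw [occ_succ, Function.update_self, occ_congr (w' := w) fun s hs =>
    Function.update_of_ne (by omega) _ _]
  by_cases h : b = i
  · subst h
    simp
  · simp [h, Function.update_of_ne (Ne.symm h)]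

theorem SortInv.setNat_rnd {t : ℕ} {s : Store} (h : SortInv M t s) (n : ℕ) :
    SortInv M t (s.setNat RND 0 n) := by
  obtain ⟨h1, h2, h3, h4, h5⟩ := h
  constructor <;> simpa [Store.setNat_nat, Store.setNat_real]

theorem sortCode_run {s : Store} (hs : SortInv M 0 s) : SortInv M T (sortCode.run M T s) := by
  refine Code.run_count M T .horizon (SortInv M) (hs.setNat_rnd 0) fun t ht s hc h => ?_
  apply SortInv.setNat_rnd
  obtain ⟨h1, h2, h3, h4, h5⟩ := h
  set w := s.nat ITEM
  simp only [Code.run_seq]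
  set s₁ := (Code.setReal TOP (.var RND) (.var LAST)).run M T s with hs₁
  have hs₁ : s₁ = s.setReal TOP t (s.real LAST 0) := by
    rw [hs₁, Code.run_setReal, NExp.eval_var, RExp.eval_var, hc]
  have hn₁ : s₁.nat = s.nat := by rw [hs₁, Store.setReal_nat]
  set s₂ := pickCode.run M T s₁
  have hn₂ : ∀ a, a ∉ pickCode.natWrites → s₂.nat a = s.nat a := fun a ha => by
    rw [Code.run_nat M T _ _ ha, hn₁]
  have hr₂ : ∀ a, s₂.real a = s₁.real a := fun a =>
    Code.run_real M T _ _ (by simp [pickCode, Code.realWrites])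
  obtain ⟨hp₁, hp₂⟩ := pickCode_run (M := M) (T := T) (s := s₁) (x := Competition.count w t)
    (fun i => by rw [hn₁, h2]; rfl) (by rw [hs₁]; simpa [Store.setReal_real] using h4)
  set b := s₂.nat BEST 0 with hb
  have hrnd : s₂.nat RND 0 = t := by rw [hn₂ _ (by decide), hc]
  have hitem : s₂.nat ITEM = w := hn₂ _ (by decide)
  have hcnt : s₂.nat CNT = occ w t := by rw [hn₂ _ (by decide), h2]
  have hlast : s₂.real LAST 0 = M.top (Competition.count w t) := by
    rw [hr₂, hs₁]
    simpa [Store.setReal_real] using h3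
  set s₃ := (Code.setNat CNT (.var BEST) (.add (.get CNT (.var BEST)) (.lit 1))).run M T
    ((Code.setNat ITEM (.var RND) (.var BEST)).run M T s₂) with hs₃
  have hs₃ : s₃ = (s₂.setNat ITEM t b).setNat CNT b (occ w t b + 1) := by
    rw [hs₃, Code.run_setNat, Code.run_setNat]
    simp only [NExp.eval, NExp.eval_var, Store.setNat_nat, hrnd, hcnt]
    simp [hb]
  have hitem₃ : s₃.nat ITEM = Function.update w t b := by
    rw [hs₃]
    simp [Store.setNat_nat, hitem]
  have hcnt₃ : s₃.nat CNT = occ (Function.update w t b) (t + 1) := by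
    rw [hs₃, occ_update_succ]
    simp [Store.setNat_nat, hcnt]
  have hr₃ : s₃.real = s₂.real := by rw [hs₃, Store.setNat_real, Store.setNat_real]
  have hbest₃ : (NExp.var BEST).eval k T s₃ = b := by
    rw [hs₃]
    simp [NExp.eval_var, Store.setNat_nat, hb]
  have hw : ∀ r ≤ t, (Competition.count (Function.update w t b) r : Fin k → ℕ) =
      Competition.count w r := fun r hr => Competition.count_congr fun q hq =>
    Function.update_of_ne (by omega) _ _
  have hup : Function.update w t b t = b := Function.update_self ..
  have hval : M.top (Competition.count (Function.update w t b) (t + 1)) =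
      max (s₃.real LAST 0) ((RExp.genMean (.var BEST) (.get CNT (.var BEST))).eval M T s₃) := by
    rw [hr₃, hlast]
    by_cases hbk : b < k
    · rw [Competition.count_succ_arm (i := ⟨b, hbk⟩) hup, M.top_add_single, hw t le_rfl,
        RExp.eval_genMean (j := ⟨b, hbk⟩) hbest₃, NExp.eval, hbest₃, hcnt₃, occ_update_succ,
        Function.update_self]
      rfl
    · rw [Competition.count_succ_none (by rwa [hup]), hw t le_rfl]
      have : (RExp.genMean (.var BEST) (.get CNT (.var BEST))).eval M T s₃ = 0 := by
        simp [RExp.genMean, RExp.eval, hbest₃, hbk]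
      rw [this, max_eq_left (M.low_nonneg.trans (M.top_mem _).1)]
  suffices hfin : ∀ s' : Store, s'.nat = s₃.nat → (∀ a ≠ LAST, s'.real a = s₃.real a) →
      s'.real LAST 0 = M.top (Competition.count (Function.update w t b) (t + 1)) →
      SortInv M (t + 1) s' by
    by_cases hle : (BExp.realLe (.genMean (.var BEST) (.get CNT (.var BEST)))
        (.var LAST)).Holds M T s₃
    · rw [Code.run_cond_of_holds _ _ _ _ hle]
      refine hfin _ rfl (fun _ _ => rfl) ?_
      rw [hval]
      exact (max_eq_left hle).symm
    · rw [Code.run_cond_of_not_holds _ _ _ _ hle, Code.run_setReal]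
      refine hfin _ rfl (fun a ha => by simp [Store.setReal_real, ha]) ?_
      rw [hval]
      refine Eq.trans ?_ (max_eq_right (not_le.1 hle).le).symm
      simp [Store.setReal_real, NExp.eval]
  intro s' hn hr hl
  refine ⟨?_, ?_, ?_, ?_, ?_⟩
  · rw [hn, hitem₃]
    exact h1.snoc hp₁ hp₂
  · rw [hn, hcnt₃, hitem₃]
  · rw [hn, hitem₃, hl]
  · rw [hr _ (by decide), hr₃, hr₂, hs₁]
    simpa [Store.setReal_real] using h4
  · intro r hrt
    rw [hr _ (by decide), hr₃, hr₂, hs₁, hn, hitem₃, hw r (by omega)]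
    rcases (Nat.lt_succ_iff.1 hrt).lt_or_eq with hrt | rfl
    · simpa [Store.setReal_real, Function.update_of_ne hrt.ne] using h5 r hrt
    · simpa [Store.setReal_real] using h3

theorem candidateCode_run {s : Store} {w : ℕ → ℕ} {t : ℕ} {j : Fin k}
    (hc : s.nat CNT = occ w t) (htop : ∀ r ≤ T, s.real TOP r = M.top (Competition.count w r))
    (hp : s.nat POS 0 = t) (ht : t ≤ T) (hj : s.nat ARM 0 = j) (hn : s.nat NEXT j ≤ T) :
    (candidateCode.run M T s).real CAND 0 =
      M.candidate w (s.real VAL) t j (s.nat NEXT j) := by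
  simp only [candidateCode, Code.run_seq]
  set t' := s.nat NEXT j with ht'
  set s₁ := (Code.setReal LEVEL (.lit 0) (.get TOP (.get NEXT (.var ARM)))).run M T s with hs₁
  have hs₁ : s₁ = s.setReal LEVEL 0 (M.top (Competition.count w t')) := by
    rw [hs₁, Code.run_setReal]
    simp only [NExp.eval, RExp.eval, NExp.eval_var, hj, ← ht', htop _ hn]
  set s₂ := sumCode.run M T s₁
  have hn₂ : ∀ a, a ∉ sumCode.natWrites → s₂.nat a = s.nat a := fun a ha => by
    rw [Code.run_nat M T _ _ ha, hs₁, Store.setReal_nat]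
  have hr₂ : ∀ a, a ∉ sumCode.realWrites → s₂.real a = s₁.real a := fun a ha =>
    Code.run_real M T _ _ ha
  have hsum : s₂.real SUM 0 = M.credit w t t' :=
    sumCode_run_eq_credit (by rw [hs₁, Store.setReal_nat, hc])
      (by rw [hs₁]; simp [Store.setReal_real])
  set s₃ := (Code.setReal CAND (.lit 0)
    (.sub (.get VAL (.get NEXT (.var ARM))) (.var SUM))).run M T s₂ with hs₃
  have hs₃ : s₃ = s₂.setReal CAND 0 (s.real VAL t' - M.credit w t t') := by
    rw [hs₃, Code.run_setReal]
    simp only [NExp.eval, RExp.eval, NExp.eval_var, RExp.eval_var, hsum, hn₂ NEXT (by decide),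
      hn₂ ARM (by decide), hj, ← ht', hr₂ VAL (by decide)]
    rw [hs₁]
    simp [Store.setReal_real]
  have hfix : ∀ s' : Store, s'.nat = s₃.nat → (∀ a ≠ CAND, s'.real a = s₃.real a) →
      (NExp.var ARM).eval k T s' = j ∧
      (RExp.get TOP (.var POS)).eval M T s' = M.top (Competition.count w t) ∧
      (RExp.var LEVEL).eval M T s' = M.top (Competition.count w t') := by
    intro s' hn hr
    rw [hs₃] at hn hr
    refine ⟨?_, ?_, ?_⟩
    · rw [NExp.eval_var, hn, Store.setReal_nat, hn₂ _ (by decide), hj]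
    · rw [RExp.eval, NExp.eval_var, hn, Store.setReal_nat, hn₂ _ (by decide), hp,
        hr _ (by decide), ← htop t ht]
      simp [Store.setReal_real, hr₂ TOP (by decide), hs₁]
    · rw [RExp.eval_var, hr _ (by decide)]
      simp [Store.setReal_real, hr₂ LEVEL (by decide), hs₁]
  obtain ⟨ha₃, hp₃, -⟩ := hfix s₃ rfl fun _ _ => rfl
  set s₄ := (Code.cond (.accepts (.var ARM) (.get TOP (.var POS)))
    (.setReal CAND (.lit 0)
      (.add (.var CAND) (.reward (.var ARM) (.get TOP (.var POS))))) .skip).run M T s₃ with hs₄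
  have hs₄ : s₄ = s₃.setReal CAND 0 (s₃.real CAND 0 + M.posGain j (Competition.count w t)) := by
    by_cases hb : (BExp.accepts (.var ARM) (.get TOP (.var POS))).Holds M T s₃
    · rw [hs₄, Code.run_cond_of_holds _ _ _ _ hb, Code.run_setReal]
      rw [BExp.holds_accepts ha₃, hp₃] at hb
      simp only [RExp.eval, RExp.eval_reward ha₃, RExp.eval_var, NExp.eval] at hp₃ ⊢
      rw [hp₃, Competition.posGain, Competition.gain, max_eq_left hb]
    · rw [hs₄, Code.run_cond_of_not_holds _ _ _ _ hb, Code.run_skip]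
      rw [BExp.holds_accepts ha₃, hp₃, not_le] at hb
      rw [Competition.posGain, Competition.gain, max_eq_right hb.le, add_zero]
      simp [Store.setReal]
  have hn₄ : s₄.nat = s₃.nat := by rw [hs₄, Store.setReal_nat]
  have hr₄ : ∀ a ≠ CAND, s₄.real a = s₃.real a := fun a ha => by
    rw [hs₄]
    simp [Store.setReal_real, ha]
  have hv₄ : s₄.real CAND 0 = s.real VAL t' - M.credit w t t' +
      M.posGain j (Competition.count w t) := by
    rw [hs₄, hs₃]
    simp [Store.setReal_real]
  obtain ⟨ha₄, -, hl₄⟩ := hfix s₄ hn₄ hr₄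
  have hpos : M.posGain j (Competition.count w t') =
      max (M.σ (M.μ j) (M.top (Competition.count w t')) - M.c j) 0 := rfl
  rw [Competition.candidate]
  by_cases hb : (BExp.accepts (.var ARM) (.var LEVEL)).Holds M T s₄
  · rw [Code.run_cond_of_holds _ _ _ _ hb, Code.run_setReal]
    rw [BExp.holds_accepts ha₄, hl₄] at hb
    simp only [RExp.eval, RExp.eval_reward ha₄, hl₄, NExp.eval, Store.setReal_real, if_true,
      Function.update_self]
    rw [RExp.eval_var, hv₄, hpos, max_eq_left hb]
    ring
  · rw [Code.run_cond_of_not_holds _ _ _ _ hb, Code.run_skip]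
    rw [BExp.holds_accepts ha₄, hl₄, not_le] at hb
    rw [hv₄, hpos, max_eq_right hb.le]
    ring

/-- `m` is the highest of `0` and the values of the candidates among the first `n` arms, and `r`
is a choice that attains it. -/
structure IsBest (M : Competition k) (w nx : ℕ → ℕ) (U : ℕ → ℝ) (t n : ℕ) (m : ℝ) (r : ℕ) :
    Prop where
  nonneg : 0 ≤ m
  upper : ∀ j : Fin k, j < n → nx j ≠ 0 → M.candidate w U t j (nx j) ≤ m
  attained : (r = 0 ∧ m = 0) ∨ ∃ j : Fin k, nx j ≠ 0 ∧ r = nx j ∧ m = M.candidate w U t j r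

/-- Invariant of `bestCode`, which is started in memory `s`. -/
structure BestInv (M : Competition k) (w : ℕ → ℕ) (t : ℕ) (s : Store) (n : ℕ) (s' : Store) :
    Prop where
  cnt : s'.nat CNT = s.nat CNT
  pos : s'.nat POS = s.nat POS
  next : s'.nat NEXT = s.nat NEXT
  top : s'.real TOP = s.real TOP
  val : s'.real VAL = s.real VAL
  best : IsBest M w (s.nat NEXT) (s.real VAL) t n (s'.real MAX 0) (s'.nat SUCC t)
  other : ∀ r ≠ t, s'.nat SUCC r = s.nat SUCC r

theorem BestInv.setNat_arm {w : ℕ → ℕ} {t n : ℕ} {s s' : Store} (h : BestInv M w t s n s')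
    (m : ℕ) : BestInv M w t s n (s'.setNat ARM 0 m) := by
  obtain ⟨h1, h2, h3, h4, h5, h6, h7⟩ := h
  constructor <;> simpa [Store.setNat_nat, Store.setNat_real]

theorem bestCode_run {s : Store} {w : ℕ → ℕ} {t : ℕ}
    (hc : s.nat CNT = occ w t) (htop : ∀ r ≤ T, s.real TOP r = M.top (Competition.count w r))
    (hp : s.nat POS 0 = t) (ht : t ≤ T) (hn : ∀ j : Fin k, s.nat NEXT j ≤ T) :
    BestInv M w t s k (bestCode.run M T s) := by
  simp only [bestCode, Code.run_seq]
  set s₁ := (Code.setNat SUCC (.var POS) (.lit 0)).run M T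
    ((Code.setReal MAX (.lit 0) (.cast (.lit 0))).run M T s) with hs₁
  have hs₁ : s₁ = (s.setReal MAX 0 0).setNat SUCC t 0 := by
    rw [hs₁, Code.run_setNat, Code.run_setReal]
    simp [NExp.eval, RExp.eval, NExp.eval_var, Store.setReal_nat, hp]
  refine Code.run_count M T .arms (c := ARM) (s := s₁) (BestInv M w t s) ?_ ?_
  · apply BestInv.setNat_arm
    rw [hs₁]
    constructor
    case best => constructor <;> simp [Store.setNat_nat, Store.setNat_real, Store.setReal_real]
    case other =>
      intro r hr
      simp [Store.setNat_nat, Store.setReal_nat, Function.update_of_ne hr]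
    all_goals simp [Store.setNat_nat, Store.setNat_real, Store.setReal_nat, Store.setReal_real]
  · rintro n hn' s' hj ⟨h1, h2, h3, h4, h5, h6, h7⟩
    apply BestInv.setNat_arm
    have hn' : n < k := hn'
    have hj' : s'.nat ARM 0 = (⟨n, hn'⟩ : Fin k) := hj
    have hnx : (NExp.get NEXT (.var ARM)).eval k T s' = s.nat NEXT n := by
      rw [NExp.eval, NExp.eval_var, hj, h3]
    by_cases hb : (BExp.natLe (.lit 1) (.get NEXT (.var ARM))).Holds M T s'
    · rw [Code.run_cond_of_holds _ _ _ _ hb, Code.run_seq]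
      rw [BExp.Holds, hnx] at hb
      have hb : s.nat NEXT n ≠ 0 := Nat.one_le_iff_ne_zero.1 hb
      have hcand := candidateCode_run (M := M) (T := T) (s := s') (w := w) (t := t)
        (by rw [h1, hc]) (by rwa [h4]) (by rw [h2, hp]) ht hj' (by rw [h3]; exact hn ⟨n, hn'⟩)
      rw [h3, h5] at hcand
      set s₂ := candidateCode.run M T s'
      have hn₂ : ∀ a, a ∉ candidateCode.natWrites → s₂.nat a = s'.nat a := fun a ha =>
        Code.run_nat M T _ _ ha
      have hr₂ : ∀ a, a ∉ candidateCode.realWrites → s₂.real a = s'.real a := fun a ha =>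
        Code.run_real M T _ _ ha
      by_cases hle : (BExp.realLe (.var MAX) (.var CAND)).Holds M T s₂
      · rw [Code.run_cond_of_holds _ _ _ _ hle, Code.run_seq, Code.run_setReal, Code.run_setNat]
        rw [BExp.Holds, RExp.eval_var, RExp.eval_var, hr₂ MAX (by decide), hcand] at hle
        have hs : ((s₂.setReal MAX ((NExp.lit 0).eval k T s₂)
            ((RExp.var CAND).eval M T s₂)).setNat SUCC
            ((NExp.var POS).eval k T (s₂.setReal MAX ((NExp.lit 0).eval k T s₂)
              ((RExp.var CAND).eval M T s₂)))
            ((NExp.get NEXT (.var ARM)).eval k T (s₂.setReal MAX ((NExp.lit 0).eval k T s₂)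
              ((RExp.var CAND).eval M T s₂)))) =
            (s₂.setReal MAX 0 (M.candidate w (s.real VAL) t ⟨n, hn'⟩ (s.nat NEXT n))).setNat
              SUCC t (s.nat NEXT n) := by
          simp only [NExp.eval, NExp.eval_var, RExp.eval_var, Store.setReal_nat, hcand,
            hn₂ NEXT (by decide), hn₂ ARM (by decide), hn₂ POS (by decide), h3, h2, hp, hj]
        rw [hs]
        constructor
        case best =>
          simp only [Store.setNat_nat, Store.setNat_real, Store.setReal_real, if_true,
            Function.update_self]
          refine ⟨h6.nonneg.trans hle, fun j hj hz => ?_, Or.inr ⟨⟨n, hn'⟩, hb, rfl, rfl⟩⟩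
          rcases (Nat.lt_succ_iff.1 hj).lt_or_eq with hj | rfl
          · exact (h6.upper j hj hz).trans hle
          · exact le_rfl
        case other =>
          intro r hr
          simp [Store.setNat_nat, Store.setReal_nat, Function.update_of_ne hr,
            hn₂ SUCC (by decide), h7 r hr]
        all_goals simp [Store.setNat_nat, Store.setNat_real, Store.setReal_nat,
          Store.setReal_real, hn₂ CNT (by decide), hn₂ POS (by decide), hn₂ NEXT (by decide),
          hr₂ TOP (by decide), hr₂ VAL (by decide), h1, h2, h3, h4, h5]
      · rw [Code.run_cond_of_not_holds _ _ _ _ hle, Code.run_skip]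
        rw [BExp.Holds, RExp.eval_var, RExp.eval_var, hr₂ MAX (by decide), hcand, not_le] at hle
        constructor
        case best =>
          rw [hr₂ MAX (by decide), hn₂ SUCC (by decide)]
          refine ⟨h6.nonneg, fun j hj hz => ?_, h6.attained⟩
          rcases (Nat.lt_succ_iff.1 hj).lt_or_eq with hj | rfl
          · exact h6.upper j hj hz
          · exact hle.le
        case other =>
          intro r hr
          rw [hn₂ SUCC (by decide), h7 r hr]
        all_goals simp [hn₂ CNT (by decide), hn₂ POS (by decide), hn₂ NEXT (by decide),
          hr₂ TOP (by decide), hr₂ VAL (by decide), h1, h2, h3, h4, h5]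
    · rw [Code.run_cond_of_not_holds _ _ _ _ hb, Code.run_skip]
      rw [BExp.Holds, hnx] at hb
      have hb : s.nat NEXT n = 0 := by
        simp only [NExp.eval] at hb
        omega
      refine ⟨h1, h2, h3, h4, h5, ⟨h6.nonneg, fun j hj hz => ?_, h6.attained⟩, h7⟩
      rcases (Nat.lt_succ_iff.1 hj).lt_or_eq with hj | rfl
      · exact h6.upper j hj hz
      · exact absurd hb hz

/-- Invariant of `solveCode`: the sorted run `w` has been processed from `T` down to `t`. -/
structure SolveInv (M : Competition k) (T : ℕ) (w : ℕ → ℕ) (t : ℕ) (s : Store) : Prop where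
  item : s.nat ITEM = w
  cnt : s.nat CNT = occ w t
  top : ∀ r ≤ T, s.real TOP r = M.top (Competition.count w r)
  next : NextSpec k T w t (s.nat NEXT)
  bell : M.IsBellman t T w (s.real VAL) (s.nat SUCC)

theorem SolveInv.setNat_rnd {w : ℕ → ℕ} {t : ℕ} {s : Store} (h : SolveInv M T w t s) (n : ℕ) :
    SolveInv M T w t (s.setNat RND 0 n) := by
  obtain ⟨h1, h2, h3, h4, h5⟩ := h
  constructor <;> simpa [Store.setNat_nat, Store.setNat_real]

theorem candidate_congr {w : ℕ → ℕ} {U V : ℕ → ℝ} {t : ℕ} {j : Fin k} {t' : ℕ} (h : U t' = V t') :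
    M.candidate w U t j t' = M.candidate w V t j t' := by
  rw [Competition.candidate, Competition.candidate, h]

theorem bellmanCode_run {s : Store} {w : ℕ → ℕ} {t : ℕ} (ht : t < T)
    (h : SolveInv M T w (t + 1) s) (hr : s.nat RND 0 = T - (t + 1)) :
    SolveInv M T w t (bellmanCode.run M T s) := by
  obtain ⟨h1, h2, h3, h4, h5⟩ := h
  simp only [bellmanCode, Code.run_seq]
  set s₁ := (Code.setNat NEXT (.get ITEM (.var POS)) (.add (.var POS) (.lit 1))).run M T
    ((Code.setNat CNT (.get ITEM (.var POS)) (.sub (.get CNT (.get ITEM (.var POS)))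
      (.lit 1))).run M T ((Code.setNat POS (.lit 0)
        (.sub .horizon (.add (.var RND) (.lit 1)))).run M T s)) with hs₁
  have hpos : T - (T - (t + 1) + 1) = t := by omega
  have hs₁ : s₁ = ((s.setNat POS 0 t).setNat CNT (w t) (s.nat CNT (w t) - 1)).setNat NEXT (w t)
      (t + 1) := by
    rw [hs₁, Code.run_setNat, Code.run_setNat, Code.run_setNat]
    simp [NExp.eval, NExp.eval_var, Store.setNat_nat, hr, hpos, h1]
  have hcnt₁ : s₁.nat CNT = occ w t := by
    rw [hs₁]
    funext i
    simp only [Store.setNat_nat, h2]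
    by_cases hi : w t = i
    · subst hi
      simp [occ_succ]
    · simp [Function.update_of_ne (Ne.symm hi), occ_succ, hi]
  have hnext₁ : s₁.nat NEXT = Function.update (s.nat NEXT) (w t) (t + 1) := by
    rw [hs₁]
    simp [Store.setNat_nat]
  have hreal₁ : s₁.real = s.real := by rw [hs₁]; rfl
  have hspec := h4.step ht
  rw [← hnext₁] at hspec
  have hbest := bestCode_run (M := M) (T := T) (s := s₁) (w := w) (t := t) hcnt₁
    (by rwa [hreal₁]) (by rw [hs₁]; simp [Store.setNat_nat]) ht.le hspec.le
  have hitem₂ : (bestCode.run M T s₁).nat ITEM = w := by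
    rw [Code.run_nat _ _ _ _ (by decide), hs₁]
    simpa [Store.setNat_nat] using h1
  set s₂ := bestCode.run M T s₁
  obtain ⟨b1, b2, b3, b4, b5, b6, b7⟩ := hbest
  have hpos₂ : s₂.nat POS 0 = t := by
    rw [b2, hs₁]
    simp [Store.setNat_nat]
  set s₃ := (Code.setReal LEVEL (.lit 0) (.get TOP (.var POS))).run M T s₂ with hs₃
  have hs₃ : s₃ = s₂.setReal LEVEL 0 (M.top (Competition.count w t)) := by
    rw [hs₃, Code.run_setReal]
    simp only [NExp.eval, RExp.eval, NExp.eval_var, hpos₂, b4, hreal₁, h3 t ht.le]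
  have hsum : (sumCode.run M T s₃).real SUM 0 = M.credit w t t :=
    sumCode_run_eq_credit (by rw [hs₃, Store.setReal_nat, b1, hcnt₁])
      (by rw [hs₃]; simp [Store.setReal_real])
  have hn₄ : ∀ a, a ∉ sumCode.natWrites → (sumCode.run M T s₃).nat a = s₂.nat a := fun a ha => by
    rw [Code.run_nat M T _ _ ha, hs₃, Store.setReal_nat]
  have hr₄ : ∀ a, a ∉ LEVEL :: sumCode.realWrites →
      (sumCode.run M T s₃).real a = s₂.real a := fun a ha => by
    rw [List.mem_cons, not_or] at ha
    rw [Code.run_real M T _ _ ha.2, hs₃, Store.setReal_real, if_neg ha.1]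
  set s₄ := sumCode.run M T s₃
  rw [Code.run_setReal]
  have hpos₄ : (NExp.var POS).eval k T s₄ = t := by
    rw [NExp.eval_var, hn₄ _ (by decide), hpos₂]
  have hval₄ : (RExp.add (.var MAX) (.var SUM)).eval M T s₄ =
      s₂.real MAX 0 + M.credit w t t := by
    rw [RExp.eval, RExp.eval_var, RExp.eval_var, hsum, hr₄ _ (by decide)]
  rw [hpos₄, hval₄]
  have hV : (s₄.setReal VAL t (s₂.real MAX 0 + M.credit w t t)).real VAL =
      Function.update (s.real VAL) t (s₂.real MAX 0 + M.credit w t t) := by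
    rw [Store.setReal_real, if_pos rfl, hr₄ _ (by decide), b5, hreal₁]
  have hS : (s₄.setReal VAL t (s₂.real MAX 0 + M.credit w t t)).nat SUCC = s₂.nat SUCC := by
    rw [Store.setReal_nat, hn₄ _ (by decide)]
  have hS' : ∀ r ≠ t, s₂.nat SUCC r = s.nat SUCC r := fun r hr => by
    rw [b7 r hr, hs₁]
    simp [Store.setNat_nat]
  rw [hreal₁] at b6
  set m := s₂.real MAX 0
  refine ⟨?_, ?_, ?_, ?_, ?_⟩
  · rw [Store.setReal_nat, hn₄ _ (by decide), hitem₂]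
  · rw [Store.setReal_nat, hn₄ _ (by decide), b1, hcnt₁]
  · rw [Store.setReal_real, if_neg (by decide), hr₄ _ (by decide), b4, hreal₁]
    exact h3
  · rw [Store.setReal_nat, hn₄ _ (by decide), b3]
    exact hspec
  · rw [hV, hS]
    have hU : ∀ r, t < r → Function.update (s.real VAL) t (m + M.credit w t t) r =
        s.real VAL r := fun r hr => Function.update_of_ne hr.ne' _ _
    have hUt : Function.update (s.real VAL) t (m + M.credit w t t) t = m + M.credit w t t :=
      Function.update_self ..
    refine ⟨?_, ?_, ?_, ?_⟩
    · rw [hU T ht]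
      exact h5.last
    · intro r hrT hr
      rcases hr.eq_or_lt with rfl | hr
      · rw [hUt]
        linarith [b6.nonneg]
      · rw [hU r hr]
        exact h5.nonneg r hrT hr
    · intro r hrT hr j t' ht' hn
      have hlt := hn.lt
      rw [candidate_congr (hU t' (by omega))]
      rcases hr.eq_or_lt with rfl | hr
      · rw [hUt, add_sub_cancel_right]
        have := hspec.eq j.2 hn ht'
        have h := b6.upper j j.2 (by omega)
        rwa [this] at h
      · rw [hU r hr]
        exact h5.upper r hrT hr j t' ht' hn
    · intro r hrT hr
      rcases hr.eq_or_lt with rfl | hr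
      · rw [hUt]
        rcases b6.attained with ⟨hz, hm⟩ | ⟨j, hz, hj, hm⟩
        · left
          exact ⟨hz, by rw [hm, zero_add]⟩
        · right
          rcases hspec j j.2 with ⟨hz', -⟩ | ⟨hn, hT⟩
          · exact absurd hz' hz
          · refine ⟨j, by rwa [hj], by rwa [hj], ?_⟩
            have := hn.lt
            rw [add_sub_cancel_right, candidate_congr (hU _ (by omega)), hm]
      · rw [hU r hr, hS' r hr.ne']
        rcases h5.attained r hrT hr with h | ⟨j, hn, hT, hj⟩
        · exact Or.inl h
        · refine Or.inr ⟨j, hn, hT, ?_⟩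
          have := hn.lt
          rw [candidate_congr (hU _ (by omega)), hj]

theorem solveCode_run {s : Store} (h : SortInv M T s) (hn : s.nat NEXT = fun _ => 0) :
    SolveInv M T (s.nat ITEM) 0 (solveCode.run M T s) := by
  obtain ⟨h1, h2, h3, h4, h5⟩ := h
  set w := s.nat ITEM with hw
  simp only [solveCode, Code.run_seq]
  set s₁ := (Code.setReal LEVEL (.lit 0) (.var LAST)).run M T
    ((Code.setReal TOP .horizon (.var LAST)).run M T s) with hs₁
  have hs₁ : s₁ = (s.setReal TOP T (s.real LAST 0)).setReal LEVEL 0 (s.real LAST 0) := by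
    rw [hs₁, Code.run_setReal, Code.run_setReal]
    simp [NExp.eval, RExp.eval_var, Store.setReal_real]
  have hsum : (sumCode.run M T s₁).real SUM 0 = M.credit w T T :=
    sumCode_run_eq_credit (by rw [hs₁]; exact h2)
      (by rw [hs₁]; simpa [Store.setReal_real] using h3)
  have hn₂ : ∀ a, a ∉ sumCode.natWrites → (sumCode.run M T s₁).nat a = s.nat a := fun a ha => by
    rw [Code.run_nat M T _ _ ha, hs₁]
    rfl
  have hr₂ : ∀ a, a ∉ sumCode.realWrites →
      (sumCode.run M T s₁).real a = s₁.real a := fun a ha => Code.run_real M T _ _ ha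
  set s₂ := sumCode.run M T s₁
  set s₃ := (Code.setReal VAL .horizon (.var SUM)).run M T s₂ with hs₃
  have hs₃ : s₃ = s₂.setReal VAL T (M.credit w T T) := by
    rw [hs₃, Code.run_setReal, NExp.eval, RExp.eval_var, hsum]
  have hinv : SolveInv M T w T s₃ := by
    rw [hs₃]
    refine ⟨?_, ?_, ?_, ?_, ?_, fun t ht ht' => ?_, fun t ht ht' => ?_, fun t ht ht' => ?_⟩
    · rw [Store.setReal_nat, hn₂ _ (by decide)]
    · rw [Store.setReal_nat, hn₂ _ (by decide), h2]
    · intro r hr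
      rw [Store.setReal_real, if_neg (by decide), hr₂ _ (by decide), hs₁]
      rcases hr.lt_or_eq with hr | rfl
      · simpa [Store.setReal_real, Function.update_of_ne hr.ne] using h5 r hr
      · simpa [Store.setReal_real] using h3
    · rw [Store.setReal_nat, hn₂ _ (by decide), hn]
      exact fun j _ => Or.inl ⟨rfl, fun s hs hs' => absurd hs' (by omega)⟩
    · simp [Store.setReal_real]
    all_goals omega
  have := Code.run_count M T .horizon (c := RND) (s := s₃) (p := bellmanCode)
    (fun n => SolveInv M T w (T - n)) (hinv.setNat_rnd 0) fun n hnT s' hc h' => by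
      have hnT : n < T := hnT
      apply SolveInv.setNat_rnd
      refine bellmanCode_run (t := T - (n + 1)) (by omega) ?_ (by omega)
      rwa [show T - (n + 1) + 1 = T - n by omega]
  rwa [show T - Limit.horizon.val k T = 0 from Nat.sub_self T] at this

/-- Invariant of `outputCode`, with `U` and `succ` computed by `solveCode`. -/
structure WriteInv (M : Competition k) (T : ℕ) (w : ℕ → ℕ) (U : ℕ → ℝ) (succ : ℕ → ℕ) (v : ℝ)
    (n : ℕ) (s : Store) : Prop where
  item : s.nat ITEM = w
  succ : s.nat SUCC = succ
  top : ∀ r ≤ T, s.real TOP r = M.top (Competition.count w r)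
  out : M.OutputInv T w U v (s.nat OUT) (s.nat TGT 0) n

theorem WriteInv.setNat_rnd {w : ℕ → ℕ} {U : ℕ → ℝ} {succ : ℕ → ℕ} {v : ℝ} {n : ℕ} {s : Store}
    (h : WriteInv M T w U succ v n s) (m : ℕ) :
    WriteInv M T w U succ v n (s.setNat RND 0 m) := by
  obtain ⟨h1, h2, h3, h4⟩ := h
  constructor <;> simpa [Store.setNat_nat, Store.setNat_real]

theorem emits_of_holds {s : Store} {e : NExp} {y : RExp} {i : ℕ} {x : Fin k → ℕ}
    (he : e.eval k T s = i) (hy : y.eval M T s = M.top x)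
    (h : (BExp.accepts e y).Holds M T s) : M.Emits i x i := by
  refine Or.inl ⟨rfl, fun j hj => ?_⟩
  rwa [BExp.holds_accepts (j := j) (he.trans hj), hy] at h

theorem emits_of_not_holds {s : Store} {e : NExp} {y : RExp} {i : ℕ} {x : Fin k → ℕ}
    (he : e.eval k T s = i) (hy : y.eval M T s = M.top x)
    (h : ¬ (BExp.accepts e y).Holds M T s) : M.Emits i x k := by
  refine Or.inr ⟨rfl, fun j hj => ?_⟩
  rwa [BExp.holds_accepts (j := j) (he.trans hj), hy, not_le] at h

theorem outputCode_run {s : Store} {w : ℕ → ℕ} (h : SolveInv M T w 0 s)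
    (htgt : s.nat TGT 0 = 0) :
    s.real VAL 0 - M.credit w 0 0 ≤ M.util ((outputCode.run M T s).nat OUT) T := by
  obtain ⟨h1, -, h3, -, h5⟩ := h
  set U := s.real VAL
  set succ := s.nat SUCC
  set v := U 0 - M.credit w 0 0 with hv
  refine (Code.run_count M T .horizon (c := RND) (s := s) (WriteInv M T w U succ v) ?_ ?_).out.le_util
    h5
  · apply WriteInv.setNat_rnd
    refine ⟨h1, rfl, h3, Or.inl ⟨htgt.symm, fun i => ?_, ?_⟩⟩
    · exact (occ_zero _ _).trans_le (Nat.zero_le _)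
    · simp [Competition.util, hv]
  · rintro n hn s hc ⟨h1, h2, h3, h4⟩
    have hn : n < T := hn
    apply WriteInv.setNat_rnd
    rw [Code.run_seq, Code.run_setNat, NExp.eval_var, hc, NExp.eval]
    set s₁ := s.setNat OUT n k with hs₁
    have hr₁ : s₁.real = s.real := rfl
    have hn₁ : ∀ a ≠ OUT, s₁.nat a = s.nat a := fun a ha => by
      rw [hs₁, Store.setNat_nat, if_neg ha]
    have hout₁ : s₁.nat OUT n = k := by simp [hs₁, Store.setNat_nat]
    have hlow₁ : ∀ t < n, s.nat OUT t = s₁.nat OUT t := fun t ht => by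
      simp [hs₁, Store.setNat_nat, Function.update_of_ne ht.ne]
    have h4₁ : M.OutputInv T w U v (s₁.nat OUT) (s.nat TGT 0) n := h4.congr hlow₁
    have hnot : ∀ {i : ℕ}, i = k → ¬ i < k := fun h => h ▸ lt_irrefl _
    by_cases hb : (BExp.conj (.natLe (.var RND) (.var TGT))
        (.natLe (.var TGT) (.var RND))).Holds M T s₁
    · rw [Code.run_cond_of_holds _ _ _ _ hb, Code.run_seq, Code.run_setNat]
      simp only [BExp.Holds, NExp.eval_var, hn₁ RND (by decide), hn₁ TGT (by decide), hc] at hb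
      have htgt : s.nat TGT 0 = n := le_antisymm hb.2 hb.1
      rw [htgt] at h4₁
      have hsucc : (NExp.get SUCC (.var RND)).eval k T s₁ = succ n := by
        rw [NExp.eval, NExp.eval_var, hn₁ _ (by decide), hn₁ _ (by decide), hc, h2]
      rw [hsucc, NExp.eval]
      set s₂ := s₁.setNat TGT 0 (succ n) with hs₂
      have hr₂ : s₂.real = s.real := rfl
      have hn₂ : ∀ a ≠ TGT, s₂.nat a = s₁.nat a := fun a ha => by
        rw [hs₂, Store.setNat_nat, if_neg ha]
      have htgt₂ : s₂.nat TGT 0 = succ n := by simp [hs₂, Store.setNat_nat]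
      have he : (NExp.get ITEM (.sub (.var TGT) (.lit 1))).eval k T s₂ = w (succ n - 1) := by
        simp only [NExp.eval, NExp.eval_var, htgt₂, hn₂ ITEM (by decide), hn₁ ITEM (by decide), h1]
      have hrnd : (NExp.var RND).eval k T s₂ = n := by
        rw [NExp.eval_var, hn₂ _ (by decide), hn₁ _ (by decide), hc]
      have hy : (RExp.get TOP (.var RND)).eval M T s₂ = M.top (Competition.count w n) := by
        rw [RExp.eval, hrnd, hr₂, h3 n hn.le]
      by_cases hb' : (BExp.conj (.natLe (.lit 1) (.var TGT))
          (.accepts (.get ITEM (.sub (.var TGT) (.lit 1))) (.get TOP (.var RND)))).Holds M T s₂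
      · rw [Code.run_cond_of_holds _ _ _ _ hb', Code.run_setNat, he, hrnd]
        have hz : succ n ≠ 0 := by
          have := hb'.1
          simp only [BExp.Holds, NExp.eval, NExp.eval_var, htgt₂] at this
          omega
        refine ⟨?_, ?_, ?_, ?_⟩
        · rw [Store.setNat_nat, if_neg (by decide), hn₂ _ (by decide), hn₁ _ (by decide), h1]
        · rw [Store.setNat_nat, if_neg (by decide), hn₂ _ (by decide), hn₁ _ (by decide), h2]
        · rw [Store.setNat_real, hr₂]
          exact h3
        · rw [Store.setNat_nat _ _ _ _ TGT, if_neg (by decide), htgt₂, Store.setNat_nat, if_pos rfl]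
          refine Competition.OutputInv.start h5 (h4₁.congr fun t ht => ?_) hn
            (fun h => absurd h hz) fun _ => ?_
          · rw [Function.update_of_ne ht.ne, hn₂ _ (by decide)]
          · rw [Function.update_self]
            exact emits_of_holds he hy hb'.2
      · rw [Code.run_cond_of_not_holds _ _ _ _ hb', Code.run_skip]
        refine ⟨?_, ?_, ?_, ?_⟩
        · rw [hn₂ _ (by decide), hn₁ _ (by decide), h1]
        · rw [hn₂ _ (by decide), hn₁ _ (by decide), h2]
        · rw [hr₂]
          exact h3
        · rw [htgt₂, hn₂ _ (by decide)]
          refine Competition.OutputInv.start h5 h4₁ hn (fun _ => hnot hout₁) fun hz => ?_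
          rw [hout₁]
          refine emits_of_not_holds he hy fun h => hb' ⟨?_, h⟩
          simp only [BExp.Holds, NExp.eval, NExp.eval_var, htgt₂]
          omega
    · rw [Code.run_cond_of_not_holds _ _ _ _ hb]
      simp only [BExp.Holds, NExp.eval_var, hn₁ RND (by decide), hn₁ TGT (by decide), hc] at hb
      have he : (NExp.get ITEM (.sub (.var RND) (.lit 1))).eval k T s₁ = w (n - 1) := by
        simp only [NExp.eval, NExp.eval_var, hn₁ RND (by decide), hn₁ ITEM (by decide), hc, h1]
      have hrnd : (NExp.var RND).eval k T s₁ = n := by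
        rw [NExp.eval_var, hn₁ _ (by decide), hc]
      have htg : (NExp.var TGT).eval k T s₁ = s.nat TGT 0 := by
        rw [NExp.eval_var, hn₁ _ (by decide)]
      have hy : n < s.nat TGT 0 → (RExp.get TOP (.var TGT)).eval M T s₁ =
          M.top (Competition.count w (s.nat TGT 0)) := fun hlt => by
        rw [RExp.eval, htg, hr₁, h3]
        rcases h4 with ⟨h, -⟩ | ⟨-, h, -⟩ | ⟨h, -⟩ <;> omega
      by_cases hb' : (BExp.conj (.natLe (.var RND) (.var TGT))
          (.accepts (.get ITEM (.sub (.var RND) (.lit 1))) (.get TOP (.var TGT)))).Holds M T s₁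
      · rw [Code.run_cond_of_holds _ _ _ _ hb', Code.run_setNat, he, hrnd]
        have hlt : n < s.nat TGT 0 := by
          have := hb'.1
          simp only [BExp.Holds, hrnd, htg] at this
          omega
        refine ⟨?_, ?_, ?_, ?_⟩
        · rw [Store.setNat_nat, if_neg (by decide), hn₁ _ (by decide), h1]
        · rw [Store.setNat_nat, if_neg (by decide), hn₁ _ (by decide), h2]
        · rw [Store.setNat_real, hr₁]
          exact h3
        · rw [Store.setNat_nat _ _ _ _ TGT, if_neg (by decide), hn₁ _ (by decide),
            Store.setNat_nat, if_pos rfl]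
          refine Competition.OutputInv.continue (h4₁.congr fun t ht => ?_) hlt ?_
          · rw [Function.update_of_ne ht.ne]
          · rw [Function.update_self]
            exact emits_of_holds he (hy hlt) hb'.2
      · rw [Code.run_cond_of_not_holds _ _ _ _ hb', Code.run_skip]
        refine ⟨?_, ?_, ?_, ?_⟩
        · rw [hn₁ _ (by decide), h1]
        · rw [hn₁ _ (by decide), h2]
        · rw [hr₁]
          exact h3
        · rw [hn₁ TGT (by decide)]
          rcases Nat.lt_or_ge n (s.nat TGT 0) with hlt | hge
          · refine h4₁.continue hlt ?_
            rw [hout₁]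
            refine emits_of_not_holds he (hy hlt) fun h => hb' ⟨?_, h⟩
            simp only [BExp.Holds, hrnd, htg]
            omega
          · exact h4₁.finish (by omega) (hnot hout₁)

theorem algorithm_isOptimal (hγ : M.IsTimeInsensitive) (hM : M.HasExitPulls)
    (hT : M.IsLongHorizon T) :
    M.IsOptimal ((algorithm.run M T Store.zero).output k T) := by
  set s₁ := startCode.run M T Store.zero
  have hn₁ : ∀ a ≠ ARM, s₁.nat a = fun _ => 0 := fun a ha => by
    rw [Code.run_nat]
    · rfl
    · simpa [startCode, Code.natWrites] using ha
  obtain ⟨hl, hf⟩ := startCode_run (M := M) (T := T) Store.zero rfl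
  have hocc : ∀ w : ℕ → ℕ, (Competition.count w 0 : Fin k → ℕ) = 0 := fun w =>
    funext fun i => occ_zero w i
  have hsort : SortInv M 0 s₁ := by
    refine ⟨⟨by simp, by simp⟩, ?_, ?_, hf, by simp⟩
    · rw [hn₁ _ (by decide)]
      exact (funext fun i => occ_zero _ i).symm
    · rw [hocc]
      exact hl
  have hsort₂ := sortCode_run (T := T) hsort
  have hn₂ : ∀ a, a ∉ sortCode.natWrites → (sortCode.run M T s₁).nat a = s₁.nat a := fun a ha =>
    Code.run_nat M T _ _ ha
  set s₂ := sortCode.run M T s₁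
  have hsolve := solveCode_run hsort₂ (by rw [hn₂ _ (by decide), hn₁ _ (by decide)])
  have hn₃ : ∀ a, a ∉ solveCode.natWrites → (solveCode.run M T s₂).nat a = s₂.nat a :=
    fun a ha => Code.run_nat M T _ _ ha
  set s₃ := solveCode.run M T s₂
  have hout := outputCode_run hsolve
    (by rw [hn₃ _ (by decide), hn₂ _ (by decide), hn₁ _ (by decide)])
  have hopt := hsolve.bell.opt_le hsort₂.run hM hT T T.zero_le
  rw [hocc] at hopt
  refine M.isOptimal_of_opt_le_util hγ _ (w := (outputCode.run M T s₃).nat OUT) ?_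
    (hopt.trans hout)
  intro t i
  have : (algorithm.run M T Store.zero).nat OUT = (outputCode.run M T s₃).nat OUT := rfl
  rw [Store.output, ← this]
  by_cases h : (algorithm.run M T Store.zero).nat OUT t < k
  · simp [h, Fin.ext_iff]
  · simp only [h, dite_false, reduceCtorEq, false_iff]
    exact fun h' => h (h' ▸ i.2)

end RealRAM

end

theorem mainTheorem4 :
    ∃ (p : RealRAM.Prog) (C : ℕ), ∀ (k T : ℕ) [NeZero k] (M : Competition k),
      0 < T → M.IsTimeInsensitive → M.HasExitPulls → M.IsLongHorizon T →
      ∃ (n : ℕ) (s : RealRAM.Store),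
        RealRAM.Exec M T p RealRAM.Store.zero n s ∧
        n ≤ C * (T * k ^ 3) ∧
        M.IsOptimal (s.output k T) := by
  refine ⟨RealRAM.algorithm.compile, 1000, fun k T _ M hT hγ hM hL => ?_⟩
  obtain ⟨n, hn, he⟩ := RealRAM.algorithm.exists_exec M T RealRAM.algorithm_countersSafe
    RealRAM.Store.zero
  exact ⟨n, _, he, hn.trans (RealRAM.algorithm_cost_le k T (Nat.pos_of_neZero k) hT),
    RealRAM.algorithm_isOptimal hγ hM hL⟩
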